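/- Let $a,b,c,r,\mu,\sigma,\lambda>0$ be constants, and let $F$ be a distribution function on $(0,\infty)$ with finite mean and with a density $f\ge 0$ that is continuous on $[0,\infty)$ (so $F'(0+)=f(0)$) and has support the whole half line. For $\theta\in\mathbb R$ and a function $W$ put $$M(W)(x)=\lambda\Big[W(x)-\int_0^xW(x-s)\,dF(s)\Big],\qquad \mathcal L^{(\theta)}W(x)=\tfrac{\sigma^2x^2\theta^2}{2}W''(x)+[c+rx+(\mu-r)\theta x]W'(x)-M(W)(x),$$ $$\alpha_W(x)=-\frac{(\mu-r)W'(x)}{\sigma^2xW''(x)}\ \ (W''(x)\ne0),\qquad \phi_W(x)=\frac{2[M(W)(x)-(c+rx)W'(x)]}{(\mu-r)xW'(x)}\ \ (W'(x)>0),$$ and let $\alpha^*_W(x)$ be: if $W''(x)<0$, the point of $[-b,a]$ nearest to $\alpha_W(x)$; if $W''(x)>0$, $a$ when $\alpha_W(x)\le\frac{a-b}2$ and $-b$ otherwise; if $W''(x)=0$, $a$ when $\mu\ge r$ and $-b$ otherwise. Assume $\mu>r$ and $a\ge b$, and define $V$ as follows. Let $V_a$ be a $C^2$ function on $(0,\infty)$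 with $\mathcal L^{(a)}V_a=0$ on $(0,\infty)$, $V_a(0+)=1$, $V_a'(0+)=\lambda/c$ and $V_a''(0+)=\frac\lambda c\big(\frac\lambda c-F'(0+)-\frac{r+a(\mu-r)}c\big)$, and let $\varepsilon>0$ be such that $\sup_{\theta\in[-b,a]}\mathcal L^{(\theta)}V_a=\mathcal L^{(a)}V_a=0$ on $(0,\varepsilon)$. Put $\beta=\min\{a,b\}$. For $n\ge2$ let $V^{(n)}=V_a$ on $(0,\varepsilon]$ and $V^{(n)}(x)=V_a(\varepsilon)+\int_\varepsilon^xw_n(y)\,dy$ for $x\ge\varepsilon$, where $w_n\in C^1[\varepsilon,\infty)$, $w_n(\varepsilon)=V_a'(\varepsilon)$ and, for $x\ge\varepsilon$, $$w_n'(x)=2\inf_{\theta\in[-b,a],\,|\theta|>\beta/n}\frac{M(V^{(n)})(x)-[c+rx+\theta x(\mu-r)]w_n(x)}{\theta^2\sigma^2x^2}.$$ Let $x_n^*=\inf\{x>0:|\phi_{V^{(n)}}(x)|<\beta/n\}$ (with $\inf\emptyset=\infty$), $x^*=\lim_{n\to\infty}x_n^*$, and $V(x)=\lim_{n\to\infty}V^{(n)}(x)$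 for $0<x<x^*$. Then this construction can be carried out, and every function $V$ on $(0,\infty)$ obtained from it is twice continuously differentiable with $V'>0$ on $(0,\infty)$ and satisfies the following, with $S_1=\{x>0:\phi_V(x)<a\}$ and $S_2=\{x>0:\phi_V(x)>a\}$. (i) On $S_1$, $V''\neq0$ and $\sup_{\theta\in[-b,a]}\mathcal L^{(\theta)}V(x)=\mathcal L^{(\alpha_V(x))}V(x)=0$; on $S_2$, $\sup_{\theta\in[-b,a]}\mathcal L^{(\theta)}V(x)=\mathcal L^{(a)}V(x)=0$. (ii) For every $x>0$ one has $\phi_V(x)>0$, the point $\alpha_V^*(x)$ lies in $[-b,a]$, it is the unique maximizer of $\theta\mapsto\mathcal L^{(\theta)}V(x)$ over $[-b,a]$, with $\mathcal L^{(\alpha^*_V(x))}V(x)=0$, and $$\alpha_V^*(x)=\begin{cases}\alpha_V(x)=\phi_V(x)&\text{if }\phi_V(x)<a,\\ a&\text{if }\phi_V(x)\ge a.\end{cases}$$ -/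

import Mathlib

open Set Filter Topology

noncomputable section

/-- Parameters of the controlled Cramer-Lundberg model: admissible proportions `[-b, a]`, premium
rate `c`, interest rate `r`, stock return `μ`, volatility `σ`, claim intensity `lam`, and the
density `f` of the claim law `F`. The claim law has a finite mean, its density is continuous on
`[0, ∞)` (so that `F'(0+) = f 0`), and its support is the whole half line. -/
structure SurplusModel where
  a : ℝ
  b : ℝ
  c : ℝ
  r : ℝ
  μ : ℝ
  σ : ℝ
  lam : ℝ
  f : ℝ → ℝ
  a_pos : 0 < a
  b_pos : 0 < b
  c_pos : 0 < c
  r_pos : 0 < r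
  μ_pos : 0 < μ
  σ_pos : 0 < σ
  lam_pos : 0 < lam
  f_nonneg : ∀ y, 0 ≤ f y
  f_cont : ContinuousOn f (Ici 0)
  f_support : closure (Function.support f) = Ici 0
  f_integrable : MeasureTheory.IntegrableOn f (Ioi 0)
  f_integral : ∫ y in Ioi (0 : ℝ), f y = 1
  f_mean : MeasureTheory.IntegrableOn (fun y => y * f y) (Ioi 0)

namespace SurplusModel

variable (P : SurplusModel)

/-- `M(W)(x) = λ [W(x) - ∫₀ˣ W(x - s) dF(s)]`. -/
def M (W : ℝ → ℝ) (x : ℝ) : ℝ :=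
  P.lam * (W x - ∫ s in (0 : ℝ)..x, W (x - s) * P.f s)

/-- The integro-differential operator `𝓛^(θ) W (x)`. -/
def L (θ : ℝ) (W : ℝ → ℝ) (x : ℝ) : ℝ :=
  P.σ ^ 2 * x ^ 2 * θ ^ 2 / 2 * deriv (deriv W) x
    + (P.c + P.r * x + (P.μ - P.r) * θ * x) * deriv W x - P.M W x

/-- The equation `sup_{θ ∈ [-b, a]} 𝓛^(θ) W (x) = 𝓛^(θ₀) W (x) = 0` at the point `x`. -/
def SolvesHJBAt (θ₀ : ℝ) (W : ℝ → ℝ) (x : ℝ) : Prop :=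
  IsLUB ((fun θ => P.L θ W x) '' Icc (-P.b) P.a) 0 ∧ P.L θ₀ W x = 0

/-- `α_W(x) = -(μ - r) W'(x) / (σ² x W''(x))`, meaningful where `W''(x) ≠ 0`. -/
def alpha (W : ℝ → ℝ) (x : ℝ) : ℝ :=
  -((P.μ - P.r) * deriv W x) / (P.σ ^ 2 * x * deriv (deriv W) x)

open Classical in
/-- The maximizer `α*_W(x)`, by cases on the sign of `W''(x)`. -/
def alphaStar (W : ℝ → ℝ) (x : ℝ) : ℝ :=
  if deriv (deriv W) x < 0 then
    if P.a < P.alpha W x then P.a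
    else if P.alpha W x < -P.b then -P.b
    else P.alpha W x
  else if 0 < deriv (deriv W) x then
    if P.alpha W x ≤ (P.a - P.b) / 2 then P.a else -P.b
  else if P.r ≤ P.μ then P.a else -P.b

/-- `φ_W(x) = 2 [M(W)(x) - (c + r x) W'(x)] / ((μ - r) x W'(x))`. -/
def phi (W : ℝ → ℝ) (x : ℝ) : ℝ :=
  2 * (P.M W x - (P.c + P.r * x) * deriv W x) / ((P.μ - P.r) * x * deriv W x)

/-- `W` is the solution `V_γ` of the equation with constant proportion `γ`: it is `C²` on `(0, ∞)`,
`𝓛^(γ) W = 0` there, and `W(0+)`, `W'(0+)`, `W''(0+)` have the prescribed values. -/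
structure IsConstantSolution (γ : ℝ) (W : ℝ → ℝ) : Prop where
  smooth : ContDiffOn ℝ 2 W (Ioi 0)
  eq_zero : ∀ x, 0 < x → P.L γ W x = 0
  lim_zero : Tendsto W (𝓝[>] 0) (𝓝 1)
  lim_one : Tendsto (deriv W) (𝓝[>] 0) (𝓝 (P.lam / P.c))
  lim_two : Tendsto (deriv (deriv W)) (𝓝[>] 0)
    (𝓝 (P.lam / P.c * (P.lam / P.c - P.f 0 - (P.r + γ * (P.μ - P.r)) / P.c)))

/-- The operator `T w (x) = 2 inf {(M(W)(x) - [c + r x + θ x (μ - r)] w(x)) / (θ² σ² x²)}`, the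
infimum over `θ ∈ [-b, a]` with `|θ| > A`. Here `W` is the primitive of `w` beyond `ε`, glued to
`V_γ` on `(0, ε]`, so that `M(W)` is the expression `M_γ(W)` with the integral split at `ε`. -/
def T (A : ℝ) (W w : ℝ → ℝ) (x : ℝ) : ℝ :=
  2 * sInf ((fun θ => (P.M W x - (P.c + P.r * x + θ * x * (P.μ - P.r)) * w x)
      / (θ ^ 2 * P.σ ^ 2 * x ^ 2)) '' {θ | θ ∈ Icc (-P.b) P.a ∧ A < |θ|})

/-- `W` extends `Vγ` from `(0, ε]` to `(0, ∞)` by `W(x) = Vγ(ε) + ∫_ε^x w`, where `w` is a `C¹`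
solution on `[ε, ∞)` of `w' = T w`, `w(ε) = Vγ'(ε)`, with the constant cut-off `A`. -/
def IsExtension (Vγ : ℝ → ℝ) (ε A : ℝ) (W : ℝ → ℝ) : Prop :=
  (∀ x, 0 < x → x ≤ ε → W x = Vγ x) ∧
  ∃ w : ℝ → ℝ, ContDiffOn ℝ 1 w (Ici ε) ∧ w ε = deriv Vγ ε ∧
    (∀ x, ε ≤ x → W x = Vγ ε + ∫ y in ε..x, w y) ∧
    ∀ x, ε ≤ x → HasDerivWithinAt w (P.T A W w x) (Ici ε) x

/-- `β = min {a, b}`. -/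
def beta : ℝ := min P.a P.b

/-- `x_n^* = inf {x > 0 : |φ_W(x)| < β / n}` in the extended reals (`⊤` if there is no such `x`),
where `W` stands for `V^(n)`. -/
def xStar (n : ℕ) (W : ℝ → ℝ) : EReal :=
  sInf ((fun x : ℝ => (x : EReal)) '' {x : ℝ | 0 < x ∧ |P.phi W x| < P.beta / n})

/-- `V` is the function constructed (for `μ > r`) from the solution `V_a` with constant
proportion `a`: take `ε > 0` such that `V_a` solves the equation
`sup_θ 𝓛^(θ) V_a = 𝓛^(a) V_a = 0` on `(0, ε)`; let `V^(n)` be the extension of `V_a` beyond `ε`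
with cut-off `β / n` (`n ≥ 2`, so that `β / n < min {a, b}`); let `x^* = lim x_n^*`; and put
`V = lim V^(n)` on `(0, x^*)`. -/
def IsConstructedSolution (V : ℝ → ℝ) : Prop :=
  ∃ (Va : ℝ → ℝ) (ε : ℝ) (Vn : ℕ → ℝ → ℝ) (xs : EReal),
    P.IsConstantSolution P.a Va ∧
    0 < ε ∧ (∀ x, 0 < x → x < ε → P.SolvesHJBAt P.a Va x) ∧
    (∀ n : ℕ, 2 ≤ n → P.IsExtension Va ε (P.beta / n) (Vn n)) ∧
    Tendsto (fun n => P.xStar n (Vn n)) atTop (𝓝 xs) ∧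
    ∀ x : ℝ, 0 < x → (x : EReal) < xs → Tendsto (fun n => Vn n x) atTop (𝓝 (V x))

/-- `S₁ = {x > 0 : φ_V(x) < a}`. -/
def S₁ (V : ℝ → ℝ) : Set ℝ := {x | 0 < x ∧ P.phi V x < P.a}

/-- `S₂ = {x > 0 : φ_V(x) > a}`. -/
def S₂ (V : ℝ → ℝ) : Set ℝ := {x | 0 < x ∧ P.a < P.phi V x}

end SurplusModel

end

/-! Put D = M(W) - (c + rx)W' and E = (μ - r)xW', so that φ_W = 2D/E. The equation with cut-off A
says that σ²x²W''/2 is the infimum of D/θ² - E/θ over θ in [-b, a] with |θ| > A. For E > 0 and b ≤ a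
this infimum is -E²/(4D), attained at θ = φ, when A < φ ≤ a, and it is attained at θ = a when φ ≥ a.
In both cases A has disappeared (`cutInf_eq_cutInf`): as long as φ stays above the cut-off,
different cut-offs give the same equation.

Everything therefore rests on a lower bound for φ on (0, X] that does not depend on A. On (0, ε]
optimality of a means φ ≥ a. Beyond ε, testing θ = a and Grönwall bound W' from above; completing
the square, together with M(W) ≥ λ(1 - F(X)) > 0, bounds W' from below by a positive constant.
Finally, if D became too small, testing a small fixed θ would make W'' so negative that D' > 0, so D
cannot cross a certain positive level (`IsCutoffSolution.exists_phi_bound`).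

Hence on each bounded interval the V^(n) coincide for large n (`exists_stable`), x* = ∞, and V
locally solves an equation with a cut-off below φ. The optimality statements then concern a
quadratic polynomial in θ at a single point (`optimality_at`): it is minus a perfect square if φ ≤
a, and θ - a times a positive factor if φ > a.

That the construction can be carried out is shown by Picard iteration for Volterra operators. For
V_a the equation is singular at 0; an integrating factor presents V_a' as a weighted average, and
this average is iterated. -/

noncomputable section

/-! ### The infimum with cut-off. -/

namespace SurplusModel

variable (P : SurplusModel)

/-- `inf {D / θ² - E / θ : θ ∈ [-b, a], |θ| > A}`, the infimum in the operator `T`. -/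
def cutInf (A D E : ℝ) : ℝ :=
  sInf ((fun θ => D / θ ^ 2 - E / θ) '' {θ | θ ∈ Icc (-P.b) P.a ∧ A < |θ|})

variable {P} {A D E D' E' θ : ℝ}

theorem cut_nonempty (hA : 0 < A) (hAa : A < P.a) :
    {θ | θ ∈ Icc (-P.b) P.a ∧ A < |θ|}.Nonempty :=
  ⟨P.a, ⟨⟨by linarith [P.a_pos, P.b_pos], le_rfl⟩, by rwa [abs_of_pos P.a_pos]⟩⟩

/-- This is what the cut-off is for: away from θ = 0 the infimum is finite and, in
`abs_cutInf_sub_le`, Lipschitz in (D, E), with constants that blow up as A → 0. -/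
theorem abs_div_sq_sub_div_le (hA : 0 < A) (hθ : A < |θ|) :
    |D / θ ^ 2 - E / θ| ≤ |D| / A ^ 2 + |E| / A := by
  refine (abs_sub _ _).trans (add_le_add ?_ ?_)
  · rw [abs_div, abs_pow]
    gcongr
  · rw [abs_div]
    gcongr

theorem cut_bddBelow (hA : 0 < A) :
    BddBelow ((fun θ => D / θ ^ 2 - E / θ) '' {θ | θ ∈ Icc (-P.b) P.a ∧ A < |θ|}) := by
  refine ⟨-(|D| / A ^ 2 + |E| / A), ?_⟩
  rintro _ ⟨θ, hθ, rfl⟩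
  exact (abs_le.1 (abs_div_sq_sub_div_le hA hθ.2)).1

theorem cutInf_le (hA : 0 < A) (hθ : θ ∈ Icc (-P.b) P.a) (hAθ : A < |θ|) :
    P.cutInf A D E ≤ D / θ ^ 2 - E / θ :=
  csInf_le (cut_bddBelow hA) ⟨θ, ⟨hθ, hAθ⟩, rfl⟩

theorem le_cutInf (hA : 0 < A) (hAa : A < P.a) {v : ℝ}
    (h : ∀ θ ∈ Icc (-P.b) P.a, A < |θ| → v ≤ D / θ ^ 2 - E / θ) : v ≤ P.cutInf A D E := by
  refine le_csInf ((cut_nonempty hA hAa).image _) ?_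
  rintro _ ⟨θ, hθ, rfl⟩
  exact h θ hθ.1 hθ.2

theorem abs_cutInf_sub_le (hA : 0 < A) (hAa : A < P.a) :
    |P.cutInf A D E - P.cutInf A D' E'| ≤ |D - D'| / A ^ 2 + |E - E'| / A := by
  have key : ∀ D E D' E' : ℝ,
      P.cutInf A D' E' - (|D - D'| / A ^ 2 + |E - E'| / A) ≤ P.cutInf A D E := by
    intro D E D' E'
    refine le_cutInf hA hAa fun θ hθ hAθ => ?_
    have h1 := cutInf_le (D := D') (E := E') hA hθ hAθ
    have h2 := abs_le.1 (abs_div_sq_sub_div_le (D := D - D') (E := E - E') hA hAθ)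
    have h3 : (D - D') / θ ^ 2 - (E - E') / θ
        = (D / θ ^ 2 - E / θ) - (D' / θ ^ 2 - E' / θ) := by ring
    linarith [h2.1]
  have h1 := key D E D' E'
  have h2 := key D' E' D E
  rw [abs_sub_comm D' D, abs_sub_comm E' E] at h2
  exact abs_le.2 ⟨by linarith, by linarith⟩

theorem continuous_cutInf (hA : 0 < A) (hAa : A < P.a) :
    Continuous fun q : ℝ × ℝ => P.cutInf A q.1 q.2 := by
  rw [continuous_iff_continuousAt]
  intro q
  rw [ContinuousAt, tendsto_iff_dist_tendsto_zero]
  have h : Tendsto (fun z : ℝ × ℝ => |z.1 - q.1| / A ^ 2 + |z.2 - q.2| / A) (𝓝 q) (𝓝 0) := by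
    have : Continuous fun z : ℝ × ℝ => |z.1 - q.1| / A ^ 2 + |z.2 - q.2| / A := by fun_prop
    simpa using this.tendsto q
  exact squeeze_zero (fun _ => dist_nonneg) (fun z => abs_cutInf_sub_le hA hAa) h

/-- Complete the square in 1/θ. The bound is free of A, which makes it usable for estimates uniform
in the cut-off. -/
theorem neg_sq_div_le_cutInf (hA : 0 < A) (hAa : A < P.a) (hD : 0 < D) :
    -(E ^ 2 / (4 * D)) ≤ P.cutInf A D E := by
  refine le_cutInf hA hAa fun θ _ hAθ => ?_
  have hθ : θ ≠ 0 := by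
    rintro rfl
    simp at hAθ
    linarith
  have : D / θ ^ 2 - E / θ + E ^ 2 / (4 * D) = (2 * D - E * θ) ^ 2 / (4 * D * θ ^ 2) := by
    field_simp
    ring
  have h2 : 0 ≤ (2 * D - E * θ) ^ 2 / (4 * D * θ ^ 2) := by positivity
  linarith

/-- Since b ≤ a, no admissible θ exceeds a in modulus. The case E = 0 is the one met at a zero of
W'. -/
theorem div_sq_le_cutInf_zero (hA : 0 < A) (hAa : A < P.a) (hab : P.b ≤ P.a) (hD : 0 ≤ D) :
    D / P.a ^ 2 ≤ P.cutInf A D 0 := by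
  refine le_cutInf hA hAa fun θ hθ hAθ => ?_
  have h1 : |θ| ≤ P.a := abs_le.2 ⟨by linarith [hθ.1], hθ.2⟩
  have h2 : θ ^ 2 ≤ P.a ^ 2 := by
    rw [← sq_abs]
    gcongr
  have h3 : 0 < θ ^ 2 := by
    rw [← sq_abs]
    exact pow_pos (hA.trans hAθ) 2
  simp only [zero_div, sub_zero]
  gcongr

/-- The infimum is attained at `φ = 2 D / E` if this lies in `(A, a]`. -/
theorem cutInf_eq_of_le (hA : 0 < A) (hAa : A < P.a) (hE : 0 < E) (h1 : A * E < 2 * D)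
    (h2 : 2 * D ≤ P.a * E) : P.cutInf A D E = -(E ^ 2 / (4 * D)) := by
  have hD : 0 < D := by nlinarith
  refine le_antisymm ?_ (neg_sq_div_le_cutInf hA hAa hD)
  have hpos : 0 < 2 * D / E := by positivity
  refine (cutInf_le (θ := 2 * D / E) hA ⟨by linarith [P.b_pos], ?_⟩ ?_).trans_eq ?_
  · rwa [div_le_iff₀ hE]
  · rwa [abs_of_pos hpos, lt_div_iff₀ hE]
  · field_simp
    ring

/-- The infimum is attained at `a` if `φ = 2 D / E` is at least `a`. -/
theorem cutInf_eq_of_ge (hA : 0 < A) (hAa : A < P.a) (hab : P.b ≤ P.a) (hE : 0 < E)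
    (h : P.a * E ≤ 2 * D) : P.cutInf A D E = D / P.a ^ 2 - E / P.a := by
  have ha := P.a_pos
  refine le_antisymm (cutInf_le hA ⟨by linarith [P.b_pos], le_rfl⟩ (by rwa [abs_of_pos ha])) ?_
  refine le_cutInf hA hAa fun θ hθ hAθ => ?_
  have h1 : |θ| ≤ P.a := abs_le.2 ⟨by linarith [hθ.1], hθ.2⟩
  have h0 : 0 < |θ| := hA.trans hAθ
  -- As E > 0, passing from θ to |θ| lowers the value, and |θ| ≤ a because b ≤ a. For t in (0, a]
  -- the difference from the value at a has the factor a - t.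
  have h2 : D / |θ| ^ 2 - E / |θ| ≤ D / θ ^ 2 - E / θ := by
    rw [sq_abs]
    have : E / θ ≤ E / |θ| := by
      refine (le_abs_self _).trans_eq ?_
      rw [abs_div, abs_of_pos hE]
    linarith
  refine le_trans ?_ h2
  generalize |θ| = t at *
  have : D / t ^ 2 - E / t - (D / P.a ^ 2 - E / P.a)
      = (P.a - t) * (D * (P.a + t) - E * P.a * t) / (t ^ 2 * P.a ^ 2) := by
    field_simp
    ring
  have h3 : 0 ≤ (P.a - t) * (D * (P.a + t) - E * P.a * t) / (t ^ 2 * P.a ^ 2) := by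
    have : 0 ≤ D * (P.a + t) - E * P.a * t := by
      nlinarith [mul_nonneg (sub_nonneg.2 h1) (mul_pos ha hE).le,
        mul_le_mul_of_nonneg_right h (by positivity : 0 ≤ P.a + t)]
    have h4 : 0 ≤ P.a - t := by linarith
    positivity
  linarith

open scoped Pointwise in
theorem T_eq (hA : 0 < A) (W w : ℝ → ℝ) {x : ℝ} (hx : 0 < x) :
    P.T A W w x = 2 / (P.σ ^ 2 * x ^ 2) *
      P.cutInf A (P.M W x - (P.c + P.r * x) * w x) ((P.μ - P.r) * x * w x) := by
  have hσ := P.σ_pos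
  have himg : ((fun θ => (P.M W x - (P.c + P.r * x + θ * x * (P.μ - P.r)) * w x)
      / (θ ^ 2 * P.σ ^ 2 * x ^ 2)) '' {θ | θ ∈ Icc (-P.b) P.a ∧ A < |θ|})
      = (1 / (P.σ ^ 2 * x ^ 2)) • ((fun θ => (P.M W x - (P.c + P.r * x) * w x) / θ ^ 2
        - ((P.μ - P.r) * x * w x) / θ) '' {θ | θ ∈ Icc (-P.b) P.a ∧ A < |θ|}) := by
    rw [← image_smul, image_image]
    refine image_congr fun θ hθ => ?_
    have hθ0 : θ ≠ 0 := by
      rintro rfl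
      have := hθ.2
      simp at this
      linarith
    simp only [smul_eq_mul]
    field_simp
    ring
  rw [T, himg, Real.sInf_smul_of_nonneg (by positivity), smul_eq_mul, cutInf]
  ring

end SurplusModel

/-! ### Differentiation of convolutions. -/

/-- The derivative of `∫_{x₀}^x φ(x, s) ds` at `x = x₀`. -/
theorem hasDerivAt_integral_diag {φ : ℝ → ℝ → ℝ} (hφ : Continuous fun q : ℝ × ℝ => φ q.1 q.2)
    (x₀ : ℝ) : HasDerivAt (fun x => ∫ s in x₀..x, φ x s) (φ x₀ x₀) x₀ := by
  rw [hasDerivAt_iff_isLittleO, Asymptotics.isLittleO_iff]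
  intro η hη
  obtain ⟨δ, hδ, h⟩ := Metric.continuousAt_iff.1 (hφ.continuousAt (x := (x₀, x₀))) η hη
  filter_upwards [Metric.ball_mem_nhds x₀ hδ] with x hx
  have hi : IntervalIntegrable (fun s => φ x s) MeasureTheory.volume x₀ x :=
    (hφ.comp (by fun_prop : Continuous fun s : ℝ => (x, s))).intervalIntegrable _ _
  have : (∫ s in x₀..x, φ x s) - (∫ s in x₀..x₀, φ x₀ s) - (x - x₀) • φ x₀ x₀
      = ∫ s in x₀..x, (φ x s - φ x₀ x₀) := by
    rw [intervalIntegral.integral_sub hi intervalIntegrable_const]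
    simp
  rw [this, Real.norm_eq_abs (x - x₀)]
  refine intervalIntegral.norm_integral_le_of_norm_le_const fun s hs => ?_
  have hs' : |s - x₀| ≤ |x - x₀| :=
    abs_sub_left_of_mem_uIcc (uIoc_subset_uIcc hs)
  rw [Metric.mem_ball, Real.dist_eq] at hx
  refine (h (x := (x, s)) ?_).le
  rw [Prod.dist_eq, max_lt_iff, Real.dist_eq, Real.dist_eq]
  exact ⟨hx, hs'.trans_lt hx⟩

/-- The derivative of a convolution on the half line. -/
theorem hasDerivAt_convolution {W g k : ℝ → ℝ} (hg : Continuous g)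
    (hW : ∀ y, HasDerivAt W (g y) y) (hk : Continuous k) (x : ℝ) :
    HasDerivAt (fun x => ∫ s in (0 : ℝ)..x, W (x - s) * k s)
      (W 0 * k x + ∫ s in (0 : ℝ)..x, g (x - s) * k s) x := by
  have hWc : Continuous W := continuous_iff_continuousAt.2 fun y => (hW y).continuousAt
  have hi : ∀ z u v, IntervalIntegrable (fun s => W (z - s) * k s) MeasureTheory.volume u v :=
    fun z u v => (by fun_prop : Continuous fun s => W (z - s) * k s).intervalIntegrable u v
  -- Split the integral over [0, z] at the fixed point x. The piece with moving endpoint gives the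
  -- boundary term, the other is differentiated under the integral sign, so k need only be
  -- continuous.
  have h1 : HasDerivAt (fun z => ∫ s in x..z, W (z - s) * k s) (W 0 * k x) x := by
    have := hasDerivAt_integral_diag (φ := fun z s => W (z - s) * k s) (by fun_prop) x
    simpa using this
  have h2 : HasDerivAt (fun z => ∫ s in (0 : ℝ)..x, W (z - s) * k s)
      (∫ s in (0 : ℝ)..x, g (x - s) * k s) x := by
    have hc : Continuous fun q : ℝ × ℝ => g (q.1 - q.2) * k q.2 := by fun_prop
    obtain ⟨C, hC⟩ := ((isCompact_Icc (a := x - 1) (b := x + 1)).prod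
      (isCompact_uIcc (a := (0 : ℝ)) (b := x))).exists_bound_of_continuousOn hc.continuousOn
    refine (intervalIntegral.hasDerivAt_integral_of_dominated_loc_of_deriv_le
      (F := fun z s => W (z - s) * k s) (F' := fun z s => g (z - s) * k s)
      (bound := fun _ => C) (s := Icc (x - 1) (x + 1))
      (Icc_mem_nhds (by linarith) (by linarith)) ?_ (hi x _ _) ?_ ?_ ?_ ?_).2
    · exact Eventually.of_forall fun z =>
        (by fun_prop : Continuous fun s => W (z - s) * k s).aestronglyMeasurable
    · exact (by fun_prop : Continuous fun s => g (x - s) * k s).aestronglyMeasurable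
    · exact Eventually.of_forall fun s hs z hz => hC (z, s) ⟨hz, uIoc_subset_uIcc hs⟩
    · exact intervalIntegrable_const
    · refine Eventually.of_forall fun s _ z _ => ?_
      have := ((hW (z - s)).comp z ((hasDerivAt_id z).sub_const s)).mul_const (k s)
      simpa using this
  refine (h1.add h2).congr_of_eventuallyEq (Eventually.of_forall fun z => ?_)
  simp only [Pi.add_apply]
  rw [add_comm, intervalIntegral.integral_add_adjacent_intervals (hi z _ _) (hi z _ _)]

/-! ### The claim law and the operator M. -/

namespace SurplusModel

variable (P : SurplusModel)

/-- The claim density, extended continuously to the negative half line. -/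
def dens (s : ℝ) : ℝ := P.f (max s 0)

variable {P}

theorem continuous_dens : Continuous P.dens :=
  P.f_cont.comp_continuous (by fun_prop) fun _ => mem_Ici.2 (le_max_right _ _)

theorem dens_nonneg (s : ℝ) : 0 ≤ P.dens s := P.f_nonneg _

theorem dens_of_nonneg {s : ℝ} (hs : 0 ≤ s) : P.dens s = P.f s := by rw [dens, max_eq_left hs]

theorem intervalIntegrable_dens (u v : ℝ) :
    IntervalIntegrable P.dens MeasureTheory.volume u v :=
  continuous_dens.intervalIntegrable u v

theorem integral_dens_mono {x y : ℝ} (hx : 0 ≤ x) (hxy : x ≤ y) :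
    ∫ s in (0 : ℝ)..x, P.dens s ≤ ∫ s in (0 : ℝ)..y, P.dens s :=
  intervalIntegral.integral_mono_interval le_rfl hx hxy
    (Eventually.of_forall fun s => dens_nonneg s) (intervalIntegrable_dens _ _)

/-- The tail of the claim law is positive. -/
theorem integral_dens_lt_one {x : ℝ} (hx : 0 ≤ x) : ∫ s in (0 : ℝ)..x, P.dens s < 1 := by
  have h0 : ∫ s in (0 : ℝ)..x, P.dens s = ∫ s in Ioc 0 x, P.f s := by
    rw [intervalIntegral.integral_of_le hx]
    exact MeasureTheory.setIntegral_congr_fun measurableSet_Ioc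
      fun s hs => dens_of_nonneg hs.1.le
  have hsplit : (∫ s in Ioc 0 x, P.f s) + ∫ s in Ioi x, P.f s = 1 := by
    rw [← P.f_integral, ← Ioc_union_Ioi_eq_Ioi hx]
    refine (MeasureTheory.setIntegral_union (Ioc_disjoint_Ioi le_rfl) measurableSet_Ioi ?_ ?_).symm
    · exact P.f_integrable.mono_set Ioc_subset_Ioi_self
    · exact P.f_integrable.mono_set (Ioi_subset_Ioi hx)
  have hpos : 0 < ∫ s in Ioi x, P.f s := by
    rw [MeasureTheory.setIntegral_pos_iff_support_of_nonneg_ae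
      (Eventually.of_forall fun s => P.f_nonneg s) (P.f_integrable.mono_set (Ioi_subset_Ioi hx))]
    -- Full support yields a point beyond x where f ≠ 0; by continuity the set of such points in (x,
    -- ∞) is open, hence of positive measure.
    have hcl : x + 1 ∈ closure (Function.support P.f) := by
      rw [P.f_support]
      exact add_nonneg hx zero_le_one
    obtain ⟨y, hy1, hy2⟩ := mem_closure_iff.1 hcl (Ioi x) isOpen_Ioi (lt_add_one x)
    have hopen : IsOpen (Ioi x ∩ P.f ⁻¹' {0}ᶜ) :=
      (P.f_cont.mono fun s hs => hx.trans (le_of_lt hs)).isOpen_inter_preimage isOpen_Ioi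
        isOpen_compl_singleton
    refine (hopen.measure_pos MeasureTheory.volume ⟨y, hy1, hy2⟩).trans_le
      (MeasureTheory.measure_mono ?_)
    exact fun z hz => ⟨hz.2, hz.1⟩
  rw [h0]
  linarith

theorem M_eq (W : ℝ → ℝ) {x : ℝ} (hx : 0 ≤ x) :
    P.M W x = P.lam * (W x - ∫ s in (0 : ℝ)..x, W (x - s) * P.dens s) := by
  rw [M]
  congr 2
  refine intervalIntegral.integral_congr fun s hs => ?_
  rw [uIcc_of_le hx] at hs
  simp only [dens_of_nonneg hs.1]

/-- The endpoint s = x, where W(0) enters, is a null set. Functions prescribed only on (0, ∞) can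
thus be exchanged for ones regular on the whole line. -/
theorem M_congr {W₁ W₂ : ℝ → ℝ} {x : ℝ} (hx : 0 < x) (h : ∀ y, 0 < y → y ≤ x → W₁ y = W₂ y) :
    P.M W₁ x = P.M W₂ x := by
  rw [M, M, h x hx le_rfl]
  congr 2
  rw [intervalIntegral.integral_of_le hx.le, intervalIntegral.integral_of_le hx.le,
    MeasureTheory.integral_Ioc_eq_integral_Ioo, MeasureTheory.integral_Ioc_eq_integral_Ioo]
  refine MeasureTheory.setIntegral_congr_fun measurableSet_Ioo fun s hs => ?_
  rw [h (x - s) (by linarith [hs.2]) (by linarith [hs.1])]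

theorem intervalIntegrable_mul_dens {W : ℝ → ℝ} (hW : Continuous W) (x u v : ℝ) :
    IntervalIntegrable (fun s => W (x - s) * P.dens s) MeasureTheory.volume u v := by
  have := P.continuous_dens
  exact (by fun_prop : Continuous fun s => W (x - s) * P.dens s).intervalIntegrable u v

theorem continuousOn_M {W : ℝ → ℝ} (hW : Continuous W) : ContinuousOn (P.M W) (Ici 0) := by
  have hd := P.continuous_dens
  have : Continuous fun x => P.lam * (W x - ∫ s in (0 : ℝ)..x, W (x - s) * P.dens s) := by
    refine continuous_const.mul (hW.sub ?_)
    exact intervalIntegral.continuous_parametric_intervalIntegral_of_continuous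
      (f := fun x s => W (x - s) * P.dens s) (by simp only [Function.uncurry_def]; fun_prop)
      continuous_id
  exact this.continuousOn.congr fun x hx => M_eq W hx

theorem hasDerivAt_M {W g : ℝ → ℝ} (hg : Continuous g) (hW : ∀ y, HasDerivAt W (g y) y) {x : ℝ}
    (hx : 0 < x) : HasDerivAt (P.M W)
      (P.lam * (g x - (W 0 * P.dens x + ∫ s in (0 : ℝ)..x, g (x - s) * P.dens s))) x := by
  refine (((hW x).sub (hasDerivAt_convolution hg hW continuous_dens x)).const_mul
    P.lam).congr_of_eventuallyEq ?_
  filter_upwards [lt_mem_nhds hx] with z hz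
  exact M_eq W hz.le

/-- Replacing W(x - s) by the larger W(x) leaves exactly the claim mass beyond x. -/
theorem M_ge {W : ℝ → ℝ} (hW : Continuous W) {x : ℝ} (hx : 0 ≤ x)
    (hmono : ∀ y ∈ Icc 0 x, W y ≤ W x) :
    P.lam * ((1 - ∫ s in (0 : ℝ)..x, P.dens s) * W x) ≤ P.M W x := by
  rw [M_eq W hx]
  refine mul_le_mul_of_nonneg_left ?_ P.lam_pos.le
  have : ∫ s in (0 : ℝ)..x, W (x - s) * P.dens s ≤ ∫ s in (0 : ℝ)..x, W x * P.dens s := by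
    refine intervalIntegral.integral_mono_on hx (intervalIntegrable_mul_dens hW x 0 x)
      ((intervalIntegrable_dens _ _).const_mul _) fun s hs => ?_
    exact mul_le_mul_of_nonneg_right
      (hmono _ ⟨by linarith [hs.2], by linarith [hs.1]⟩) (dens_nonneg s)
  rw [intervalIntegral.integral_const_mul] at this
  linarith

theorem M_le {W : ℝ → ℝ} {x : ℝ} (hx : 0 ≤ x) (hnn : ∀ y ∈ Icc 0 x, 0 ≤ W y) :
    P.M W x ≤ P.lam * W x := by
  rw [M_eq W hx]
  refine mul_le_mul_of_nonneg_left ?_ P.lam_pos.le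
  have : 0 ≤ ∫ s in (0 : ℝ)..x, W (x - s) * P.dens s :=
    intervalIntegral.integral_nonneg hx fun s hs =>
      mul_nonneg (hnn _ ⟨by linarith [hs.2], by linarith [hs.1]⟩) (dens_nonneg s)
  linarith

theorem abs_integral_mul_dens_le {W : ℝ → ℝ} (hW : Continuous W) {x δ : ℝ} (hx : 0 ≤ x)
    (h : ∀ y ∈ Icc 0 x, |W y| ≤ δ) : |∫ s in (0 : ℝ)..x, W (x - s) * P.dens s| ≤ δ := by
  have hδ : 0 ≤ δ := (abs_nonneg _).trans (h 0 ⟨le_rfl, hx⟩)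
  calc |∫ s in (0 : ℝ)..x, W (x - s) * P.dens s|
      ≤ ∫ s in (0 : ℝ)..x, |W (x - s) * P.dens s| :=
        intervalIntegral.abs_integral_le_integral_abs hx
    _ ≤ ∫ s in (0 : ℝ)..x, δ * P.dens s := by
        refine intervalIntegral.integral_mono_on hx (intervalIntegrable_mul_dens hW x 0 x).abs
          ((intervalIntegrable_dens _ _).const_mul _) fun s hs => ?_
        rw [abs_mul, abs_of_nonneg (dens_nonneg s)]
        exact mul_le_mul_of_nonneg_right
          (h _ ⟨by linarith [hs.2], by linarith [hs.1]⟩) (dens_nonneg s)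
    _ = δ * ∫ s in (0 : ℝ)..x, P.dens s := intervalIntegral.integral_const_mul _ _
    _ ≤ δ * 1 := mul_le_mul_of_nonneg_left (integral_dens_lt_one hx).le hδ
    _ = δ := mul_one δ

/-- The claim law has mass at most 1 on [0, x], so the integral costs no more than the local term.
Only values on [0, x] enter, which makes the later fixed point problems causal. -/
theorem abs_M_sub_le {W₁ W₂ : ℝ → ℝ} (h₁ : Continuous W₁) (h₂ : Continuous W₂) {x δ : ℝ}
    (hx : 0 ≤ x) (h : ∀ y ∈ Icc 0 x, |W₁ y - W₂ y| ≤ δ) :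
    |P.M W₁ x - P.M W₂ x| ≤ 2 * P.lam * δ := by
  have h3 := abs_integral_mul_dens_le (P := P) (W := fun y => W₁ y - W₂ y) (h₁.sub h₂) hx h
  have h4 : ∫ s in (0 : ℝ)..x, (W₁ (x - s) - W₂ (x - s)) * P.dens s
      = (∫ s in (0 : ℝ)..x, W₁ (x - s) * P.dens s)
        - ∫ s in (0 : ℝ)..x, W₂ (x - s) * P.dens s := by
    rw [← intervalIntegral.integral_sub (intervalIntegrable_mul_dens h₁ x 0 x)
      (intervalIntegrable_mul_dens h₂ x 0 x)]
    simp only [sub_mul]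
  rw [h4] at h3
  rw [M_eq W₁ hx, M_eq W₂ hx, ← mul_sub, abs_mul, abs_of_pos P.lam_pos, mul_comm 2, mul_assoc]
  refine mul_le_mul_of_nonneg_left ?_ P.lam_pos.le
  have h5 := abs_le.1 (h x ⟨hx, le_rfl⟩)
  have h6 := abs_le.1 h3
  exact abs_le.2 ⟨by linarith [h5.1, h6.2], by linarith [h5.2, h6.1]⟩

end SurplusModel

/-! ### Boundary extension, Volterra equations and C² regularity. -/

/-- A function that is `C¹` on the half line up to the boundary extends to a `C¹` function. -/
theorem exists_C1_extension {W g₀ : ℝ → ℝ} {v l : ℝ} (hW : ∀ x, 0 < x → HasDerivAt W (g₀ x) x)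
    (hg₀ : ContinuousOn g₀ (Ioi 0)) (hv : Tendsto W (𝓝[>] 0) (𝓝 v))
    (hl : Tendsto g₀ (𝓝[>] 0) (𝓝 l)) :
    ∃ W' g : ℝ → ℝ, Continuous g ∧ (∀ y, HasDerivAt W' (g y) y) ∧ W' 0 = v ∧ g 0 = l ∧
      (∀ y, 0 < y → W' y = W y) ∧ ∀ y, 0 < y → g y = g₀ y := by
  set g : ℝ → ℝ := fun y => if 0 < y then g₀ y else l with hgdef
  have hgpos : ∀ y, 0 < y → g y = g₀ y := fun y hy => by simp [hgdef, hy]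
  have hgneg : ∀ y, y ≤ 0 → g y = l := fun y hy => by simp [hgdef, not_lt.2 hy]
  have hg : Continuous g := by
    rw [continuous_iff_continuousAt]
    intro y
    rcases lt_trichotomy y 0 with hy | rfl | hy
    · refine (continuousAt_const (y := l)).congr ?_
      filter_upwards [gt_mem_nhds hy] with z hz using (hgneg z hz.le).symm
    · rw [continuousAt_iff_continuous_left'_right']
      constructor
      · refine (continuousWithinAt_const (b := l)).congr (fun z hz => hgneg z (le_of_lt hz))
          (hgneg 0 le_rfl)
      · rw [ContinuousWithinAt, hgneg 0 le_rfl]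
        exact hl.congr' (by filter_upwards [self_mem_nhdsWithin] with z hz using (hgpos z hz).symm)
    · refine (hg₀.continuousAt (Ioi_mem_nhds hy)).congr ?_
      filter_upwards [lt_mem_nhds hy] with z hz using (hgpos z hz).symm
  have hW' : ∀ y, HasDerivAt (fun y => v + ∫ t in (0 : ℝ)..y, g t) (g y) y := fun y =>
    (hg.integral_hasStrictDerivAt 0 y).hasDerivAt.const_add v
  refine ⟨fun y => v + ∫ t in (0 : ℝ)..y, g t, g, hg, hW', by simp, hgneg 0 le_rfl, ?_, hgpos⟩
  have hd : ∀ x ∈ Ioi (0 : ℝ), HasDerivAt (fun y => (v + ∫ t in (0 : ℝ)..y, g t) - W y) 0 x := by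
    intro x hx
    have := (hW' x).sub (hW x hx)
    rwa [hgpos x hx, sub_self] at this
  intro y hy
  have hconst : ∀ z ∈ Ioi (0 : ℝ), (v + ∫ t in (0 : ℝ)..z, g t) - W z
      = (v + ∫ t in (0 : ℝ)..y, g t) - W y := fun z hz =>
    isOpen_Ioi.is_const_of_deriv_eq_zero (convex_Ioi (0 : ℝ)).isPreconnected
      (fun x hx => (hd x hx).differentiableAt.differentiableWithinAt)
      (fun x hx => (hd x hx).deriv) hz hy
  have hlim : Tendsto (fun y => (v + ∫ t in (0 : ℝ)..y, g t) - W y) (𝓝[>] 0) (𝓝 (v - v)) := by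
    refine Tendsto.sub ?_ hv
    have := ((hW' 0).continuousAt.tendsto).mono_left (nhdsWithin_le_nhds (s := Ioi 0))
    simpa using this
  have hlim2 : Tendsto (fun y => (v + ∫ t in (0 : ℝ)..y, g t) - W y) (𝓝[>] 0)
      (𝓝 ((v + ∫ t in (0 : ℝ)..y, g t) - W y)) :=
    tendsto_const_nhds.congr' (by
      filter_upwards [self_mem_nhdsWithin] with z hz using (hconst z hz).symm)
  have := tendsto_nhds_unique hlim2 hlim
  simp only
  linarith

/-- Uniqueness for an integral inequality of Volterra type. -/
theorem eq_zero_of_abs_le_integral {d : ℝ → ℝ} {s X K : ℝ} (hd : Continuous d)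
    (h : ∀ x ∈ Icc s X, |d x| ≤ K * ∫ y in s..x, |d y|) : ∀ x ∈ Icc s X, d x = 0 := by
  have hder : ∀ x, HasDerivAt (fun x => ∫ y in s..x, |d y|) |d x| x := fun x =>
    (hd.abs.integral_hasStrictDerivAt s x).hasDerivAt
  -- Grönwall is applied to the primitive of |d|, since d itself need not be differentiable.
  have hg := norm_le_gronwallBound_of_norm_deriv_right_le (f := fun x => ∫ y in s..x, |d y|)
    (f' := fun x => |d x|) (δ := 0) (K := K) (ε := 0) (a := s) (b := X)
    (fun x _ => (hder x).continuousAt.continuousWithinAt)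
    (fun x _ => (hder x).hasDerivWithinAt) (by simp) (fun x hx => by
      have hnn : 0 ≤ ∫ y in s..x, |d y| :=
        intervalIntegral.integral_nonneg hx.1 fun _ _ => abs_nonneg _
      rw [Real.norm_eq_abs, abs_abs, Real.norm_eq_abs, abs_of_nonneg hnn, add_zero]
      exact h x ⟨hx.1, hx.2.le⟩)
  intro x hx
  have h1 := hg x hx
  rw [gronwallBound_ε0, zero_mul, norm_le_zero_iff] at h1
  have h2 := h x hx
  rw [h1, mul_zero] at h2
  exact abs_nonpos_iff.1 h2

/-- A causal operator that is Lipschitz in the sense of Volterra has a fixed point. -/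
theorem exists_volterra_fixedPoint {s : ℝ} (Φ : (ℝ → ℝ) → ℝ → ℝ)
    (hc : ∀ w, Continuous w → Continuous (Φ w))
    (hK : ∀ X, ∃ K, 0 ≤ K ∧ ∀ w₁ w₂, Continuous w₁ → Continuous w₂ → ∀ x ∈ Icc s X,
      |Φ w₁ x - Φ w₂ x| ≤ K * ∫ y in s..x, |w₁ y - w₂ y|) :
    ∃ w, Continuous w ∧ ∀ x, s ≤ x → Φ w x = w x := by
  set u : ℕ → ℝ → ℝ := fun k => Φ^[k] (fun _ => 0) with hu
  have hus : ∀ k, u (k + 1) = Φ (u k) := fun k => Function.iterate_succ_apply' Φ k _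
  have huc : ∀ k, Continuous (u k) := by
    intro k
    induction k with
    | zero => exact continuous_const
    | succ k ih => rw [hus]; exact hc _ ih
  -- Each iteration integrates the previous bound, so the increments of the Picard iterates are
  -- bounded by terms of an exponential series, whatever the size of K.
  have hbound : ∀ X, ∃ K B, 0 ≤ K ∧ ∀ k, ∀ x ∈ Icc s X,
      |u (k + 1) x - u k x| ≤ B * ((K * (x - s)) ^ k / k.factorial) := by
    intro X
    obtain ⟨K, hK0, hK⟩ := hK X
    obtain ⟨B, hB⟩ := (isCompact_Icc (a := s) (b := X)).exists_bound_of_continuousOn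
      ((huc 1).sub (huc 0)).continuousOn
    refine ⟨K, B, hK0, fun k => ?_⟩
    induction k with
    | zero =>
      intro x hx
      simpa using hB x hx
    | succ k ih =>
      intro x hx
      rw [hus (k + 1), hus k]
      refine (hK _ _ (hus k ▸ huc (k + 1)) (huc k) x hx).trans ?_
      rw [← hus k]
      have h1 : ∫ y in s..x, |u (k + 1) y - u k y|
          ≤ ∫ y in s..x, B * ((K * (y - s)) ^ k / k.factorial) := by
        refine intervalIntegral.integral_mono_on hx.1
          (((huc (k + 1)).sub (huc k)).abs.intervalIntegrable _ _)
          ((by fun_prop : Continuous fun y => B * ((K * (y - s)) ^ k / k.factorial)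
            ).intervalIntegrable _ _)
          fun y hy => ih y ⟨hy.1, hy.2.trans hx.2⟩
      have h2 : ∫ y in s..x, B * ((K * (y - s)) ^ k / k.factorial)
          = B * (K ^ k / k.factorial) * ((x - s) ^ (k + 1) / (k + 1)) := by
        have : ∀ y, B * ((K * (y - s)) ^ k / k.factorial)
            = B * (K ^ k / k.factorial) * (y - s) ^ k := fun y => by rw [mul_pow]; ring
        simp only [this]
        rw [intervalIntegral.integral_const_mul,
          intervalIntegral.integral_comp_sub_right (fun y => y ^ k) s]
        simp
      refine (mul_le_mul_of_nonneg_left (h1.trans_eq h2) hK0).trans_eq ?_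
      rw [Nat.factorial_succ, mul_pow]
      push_cast
      field_simp
      ring
  have hunif : ∀ X, ∃ v : ℝ → ℝ, TendstoUniformlyOn u v atTop (Icc s X) := by
    intro X
    obtain ⟨K, B, hK0, hB⟩ := hbound X
    have hsum : Summable fun k : ℕ => |B| * ((K * (|X - s|)) ^ k / k.factorial) :=
      (Real.summable_pow_div_factorial _).mul_left _
    have := tendstoUniformlyOn_tsum_nat (f := fun k x => u (k + 1) x - u k x) hsum
      (s := Icc s X) (fun k x hx => by
        rw [Real.norm_eq_abs]
        refine (hB k x hx).trans ?_
        have h0 : 0 ≤ x - s := by linarith [hx.1]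
        have h1 : x - s ≤ |X - s| := (by linarith [hx.2] : x - s ≤ X - s).trans (le_abs_self _)
        gcongr
        exact le_abs_self B)
    refine ⟨_, this.congr (Eventually.of_forall fun k x _ => ?_)⟩
    simp only
    rw [Finset.sum_range_sub (fun k => u k x)]
    simp [hu]
  have hlim : ∀ x, s ≤ x → ∃ l, Tendsto (fun k => u k x) atTop (𝓝 l) := fun x hx => by
    obtain ⟨v, hv⟩ := hunif x
    exact ⟨v x, hv.tendsto_at ⟨hx, le_rfl⟩⟩
  choose! v hv using hlim
  have hvu : ∀ X, TendstoUniformlyOn u v atTop (Icc s X) := by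
    intro X
    obtain ⟨v', hv'⟩ := hunif X
    exact hv'.congr_right fun x hx => tendsto_nhds_unique (hv'.tendsto_at hx) (hv x hx.1)
  have hvc : ContinuousOn v (Ici s) := by
    intro x hx
    have h1 : ContinuousOn v (Icc s (x + 1)) :=
      (hvu (x + 1)).continuousOn (Frequently.of_forall fun k => (huc k).continuousOn)
    refine (h1 x ⟨hx, by linarith⟩).mono_of_mem_nhdsWithin ?_
    filter_upwards [self_mem_nhdsWithin, mem_nhdsWithin_of_mem_nhds (gt_mem_nhds (lt_add_one x))]
      with z hz1 hz2 using ⟨hz1, hz2.le⟩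
  -- The iterates are controlled only on [s, ∞); the limit is continued to the left as a constant to
  -- obtain a continuous argument for Φ.
  have hwc : Continuous fun x => v (max x s) :=
    hvc.comp_continuous (by fun_prop) fun _ => mem_Ici.2 (le_max_right _ _)
  refine ⟨fun x => v (max x s), hwc, fun x hx => ?_⟩
  simp only [max_eq_left hx]
  refine tendsto_nhds_unique ?_ ((tendsto_add_atTop_iff_nat 1).2 (hv x hx))
  obtain ⟨K, hK0, hK⟩ := hK x
  rw [Metric.tendsto_atTop]
  intro η hη
  have hC : 0 < K * (x - s) + 1 := by nlinarith
  obtain ⟨N, hN⟩ := eventually_atTop.1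
    (Metric.tendstoUniformlyOn_iff.1 (hvu x) (η / (K * (x - s) + 1)) (by positivity))
  refine ⟨N, fun k hk => ?_⟩
  rw [hus, Real.dist_eq]
  refine (hK (u k) _ (huc k) hwc x ⟨hx, le_rfl⟩).trans_lt ?_
  have h1 : ∫ y in s..x, |u k y - v (max y s)| ≤ ∫ y in s..x, η / (K * (x - s) + 1) := by
    refine intervalIntegral.integral_mono_on hx
      (((huc k).sub hwc).abs.intervalIntegrable _ _) intervalIntegrable_const fun y hy => ?_
    rw [max_eq_left hy.1, ← Real.dist_eq, dist_comm]
    exact (hN k hk y hy).le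
  rw [intervalIntegral.integral_const, smul_eq_mul] at h1
  refine (mul_le_mul_of_nonneg_left h1 hK0).trans_lt ?_
  rw [← mul_assoc, mul_div_assoc', div_lt_iff₀ hC]
  nlinarith

theorem contDiffOn_two_Ioi {W g g' : ℝ → ℝ} (hW : ∀ x, 0 < x → HasDerivAt W (g x) x)
    (hg : ∀ x, 0 < x → HasDerivAt g (g' x) x) (hg' : ContinuousOn g' (Ioi 0)) :
    ContDiffOn ℝ 2 W (Ioi 0) := by
  have h1 : ContDiffOn ℝ 1 g (Ioi 0) := by
    rw [show (1 : WithTop ℕ∞) = 0 + 1 from (zero_add 1).symm,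
      contDiffOn_succ_iff_deriv_of_isOpen isOpen_Ioi]
    refine ⟨fun x hx => (hg x hx).differentiableAt.differentiableWithinAt, by simp, ?_⟩
    rw [contDiffOn_zero]
    exact hg'.congr fun x hx => (hg x hx).deriv
  rw [show (2 : WithTop ℕ∞) = 1 + 1 from one_add_one_eq_two.symm,
    contDiffOn_succ_iff_deriv_of_isOpen isOpen_Ioi]
  exact ⟨fun x hx => (hW x hx).differentiableAt.differentiableWithinAt, by simp,
    h1.congr fun x hx => (hW x hx).deriv⟩

theorem deriv_deriv_eq_of_Ioi {W g g' : ℝ → ℝ} (hW : ∀ x, 0 < x → HasDerivAt W (g x) x)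
    (hg : ∀ x, 0 < x → HasDerivAt g (g' x) x) {x : ℝ} (hx : 0 < x) :
    deriv (deriv W) x = g' x := by
  refine ((hg x hx).congr_of_eventuallyEq ?_).deriv
  filter_upwards [lt_mem_nhds hx] with z hz using (hW z hz).deriv

theorem ContDiffOn.derivs_of_Ioi {W : ℝ → ℝ} (h : ContDiffOn ℝ 2 W (Ioi 0)) :
    (∀ x, 0 < x → HasDerivAt W (deriv W x) x) ∧
    (∀ x, 0 < x → HasDerivAt (deriv W) (deriv (deriv W) x) x) ∧
    ContinuousOn (deriv (deriv W)) (Ioi 0) := by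
  rw [show (2 : WithTop ℕ∞) = 1 + 1 from one_add_one_eq_two.symm,
    contDiffOn_succ_iff_deriv_of_isOpen isOpen_Ioi] at h
  obtain ⟨h1, -, h2⟩ := h
  rw [show (1 : WithTop ℕ∞) = 0 + 1 from (zero_add 1).symm,
    contDiffOn_succ_iff_deriv_of_isOpen isOpen_Ioi] at h2
  obtain ⟨h3, -, h4⟩ := h2
  exact ⟨fun x hx => (h1.differentiableAt (Ioi_mem_nhds hx)).hasDerivAt,
    fun x hx => (h3.differentiableAt (Ioi_mem_nhds hx)).hasDerivAt, h4.continuousOn⟩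

/-! ### The linear equation that is singular at the origin. -/

/-- The integrating factor of the singular equation `A x² g' + (c + B x) g = h`. -/
def singWeight (A B c x : ℝ) : ℝ := Real.exp (-(c / (A * x))) * x ^ (B / A)

/-- The derivative of `singWeight`. -/
def singWeight' (A B c x : ℝ) : ℝ := singWeight A B c x * ((c + B * x) / (A * x ^ 2))

/-- The bounded solution of `A x² g' = (c + B x) (H - g)`. -/
def singAverage (A B c : ℝ) (H : ℝ → ℝ) (x : ℝ) : ℝ :=
  if 0 < x then (∫ y in (0 : ℝ)..x, singWeight' A B c y * H y) / singWeight A B c x else H 0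

section

variable {A B c : ℝ} {H : ℝ → ℝ}

theorem singWeight_pos {x : ℝ} (hx : 0 < x) : 0 < singWeight A B c x :=
  mul_pos (Real.exp_pos _) (Real.rpow_pos_of_pos hx _)

/-- At 0 the exponential factor has the value 1, by the convention for division by zero; the
vanishing comes from the power with B/A > 0. -/
theorem singWeight_zero (hA : 0 < A) (hB : 0 < B) : singWeight A B c 0 = 0 := by
  rw [singWeight, Real.zero_rpow (div_pos hB hA).ne', mul_zero]

theorem hasDerivAt_singWeight (hA : 0 < A) {x : ℝ} (hx : 0 < x) :
    HasDerivAt (singWeight A B c) (singWeight' A B c x) x := by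
  have h1 : HasDerivAt (fun x => -(c / (A * x))) (c / (A * x ^ 2)) x := by
    have := (((hasDerivAt_id x).const_mul A).fun_inv (mul_pos hA hx).ne').const_mul (-c)
    refine (this.congr_deriv ?_).congr_of_eventuallyEq (Eventually.of_forall fun z => ?_)
    · simp only [id]
      field_simp
    · simp only [id]
      ring
  refine (h1.exp.mul (Real.hasDerivAt_rpow_const (p := B / A) (Or.inl hx.ne'))).congr_deriv ?_
  rw [singWeight', singWeight, Real.rpow_sub_one hx.ne']
  field_simp

theorem continuousOn_singWeight (hA : 0 < A) (hB : 0 < B) (hc : 0 < c) :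
    ContinuousOn (singWeight A B c) (Ici 0) := by
  intro x hx
  rcases eq_or_lt_of_le (mem_Ici.1 hx) with rfl | hx
  · rw [ContinuousWithinAt, singWeight_zero hA hB]
    have h : Tendsto (fun x : ℝ => x ^ (B / A)) (𝓝[Ici 0] 0) (𝓝 0) := by
      have := (Real.continuousAt_rpow_const (0 : ℝ) (B / A) (Or.inr (div_pos hB hA).le)).tendsto
      rw [Real.zero_rpow (div_pos hB hA).ne'] at this
      exact this.mono_left nhdsWithin_le_nhds
    refine squeeze_zero' ?_ ?_ h
    · filter_upwards [self_mem_nhdsWithin] with z hz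
      exact mul_nonneg (Real.exp_pos _).le (Real.rpow_nonneg hz _)
    · filter_upwards [self_mem_nhdsWithin] with z hz
      refine mul_le_of_le_one_left (Real.rpow_nonneg hz _) (Real.exp_le_one_iff.2 ?_)
      rw [mem_Ici] at hz
      rw [neg_nonpos]
      positivity
  · exact (hasDerivAt_singWeight hA hx).continuousAt.continuousWithinAt

theorem singWeight'_nonneg (hA : 0 < A) (hB : 0 < B) (hc : 0 < c) {x : ℝ} (hx : 0 ≤ x) :
    0 ≤ singWeight' A B c x :=
  mul_nonneg (mul_nonneg (Real.exp_pos _).le (Real.rpow_nonneg hx _)) (by positivity)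

theorem intervalIntegrable_singWeight' (hA : 0 < A) (hB : 0 < B) (hc : 0 < c) {x : ℝ}
    (hx : 0 ≤ x) : IntervalIntegrable (singWeight' A B c) MeasureTheory.volume 0 x := by
  refine intervalIntegral.intervalIntegrable_deriv_of_nonneg (g := singWeight A B c) ?_ ?_ ?_
  · rw [uIcc_of_le hx]
    exact (continuousOn_singWeight hA hB hc).mono Icc_subset_Ici_self
  · rw [min_eq_left hx, max_eq_right hx]
    exact fun y hy => hasDerivAt_singWeight hA hy.1
  · rw [min_eq_left hx, max_eq_right hx]
    exact fun y hy => singWeight'_nonneg hA hB hc hy.1.le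

/-- Consequently, for x > 0, the normalized weight is a probability density on (0, x] and
`singAverage` is a true average of H. This gives its sup-norm contraction and its continuity at 0.
-/
theorem integral_singWeight' (hA : 0 < A) (hB : 0 < B) (hc : 0 < c) {x : ℝ} (hx : 0 ≤ x) :
    ∫ y in (0 : ℝ)..x, singWeight' A B c y = singWeight A B c x := by
  rw [intervalIntegral.integral_eq_sub_of_hasDerivAt_of_le hx
    ((continuousOn_singWeight hA hB hc).mono Icc_subset_Ici_self)
    (fun y hy => hasDerivAt_singWeight hA hy.1) (intervalIntegrable_singWeight' hA hB hc hx),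
    singWeight_zero hA hB, sub_zero]

theorem intervalIntegrable_singWeight'_mul (hA : 0 < A) (hB : 0 < B) (hc : 0 < c)
    (hH : Continuous H) {x : ℝ} (hx : 0 ≤ x) :
    IntervalIntegrable (fun y => singWeight' A B c y * H y) MeasureTheory.volume 0 x :=
  (intervalIntegrable_singWeight' hA hB hc hx).mul_continuousOn hH.continuousOn

theorem singAverage_of_pos {x : ℝ} (hx : 0 < x) : singAverage A B c H x
    = (∫ y in (0 : ℝ)..x, singWeight' A B c y * H y) / singWeight A B c x := if_pos hx

theorem singAverage_of_nonpos {x : ℝ} (hx : x ≤ 0) : singAverage A B c H x = H 0 :=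
  if_neg hx.not_gt

theorem abs_integral_singWeight'_mul_le (hA : 0 < A) (hB : 0 < B) (hc : 0 < c)
    (hH : Continuous H) {x δ : ℝ} (hx : 0 ≤ x) (h : ∀ y ∈ Icc 0 x, |H y| ≤ δ) :
    |∫ y in (0 : ℝ)..x, singWeight' A B c y * H y| ≤ δ * singWeight A B c x := by
  rw [← integral_singWeight' hA hB hc hx, ← intervalIntegral.integral_const_mul]
  refine (intervalIntegral.abs_integral_le_integral_abs hx).trans ?_
  refine intervalIntegral.integral_mono_on hx
    (intervalIntegrable_singWeight'_mul hA hB hc hH hx).abs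
    ((intervalIntegrable_singWeight' hA hB hc hx).const_mul δ) fun y hy => ?_
  rw [abs_mul, abs_of_nonneg (singWeight'_nonneg hA hB hc hy.1), mul_comm]
  exact mul_le_mul_of_nonneg_right (h y hy) (singWeight'_nonneg hA hB hc hy.1)

theorem abs_singAverage_sub_le (hA : 0 < A) (hB : 0 < B) (hc : 0 < c) {H₁ H₂ : ℝ → ℝ}
    (h₁ : Continuous H₁) (h₂ : Continuous H₂) {x δ : ℝ} (hx : 0 ≤ x)
    (h : ∀ y ∈ Icc 0 x, |H₁ y - H₂ y| ≤ δ) :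
    |singAverage A B c H₁ x - singAverage A B c H₂ x| ≤ δ := by
  rcases eq_or_lt_of_le hx with rfl | hx'
  · rw [singAverage_of_nonpos le_rfl, singAverage_of_nonpos le_rfl]
    exact h 0 ⟨le_rfl, le_rfl⟩
  · rw [singAverage_of_pos hx', singAverage_of_pos hx', ← sub_div, abs_div,
      abs_of_pos (singWeight_pos hx'), div_le_iff₀ (singWeight_pos hx'),
      ← intervalIntegral.integral_sub (intervalIntegrable_singWeight'_mul hA hB hc h₁ hx)
        (intervalIntegrable_singWeight'_mul hA hB hc h₂ hx)]
    simp only [← mul_sub]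
    exact abs_integral_singWeight'_mul_le hA hB hc (h₁.sub h₂) hx h

theorem singAverage_const (hA : 0 < A) (hB : 0 < B) (hc : 0 < c) (v x : ℝ) :
    singAverage A B c (fun _ => v) x = v := by
  rcases le_or_gt x 0 with hx | hx
  · exact singAverage_of_nonpos hx
  · rw [singAverage_of_pos hx, intervalIntegral.integral_mul_const,
      integral_singWeight' hA hB hc hx.le, mul_div_cancel_left₀ _ (singWeight_pos hx).ne']

/-- With p the integrating factor, pg has derivative p'H, and p'/p = (c + Bx)/(Ax²). -/
theorem hasDerivAt_singAverage (hA : 0 < A) (hB : 0 < B) (hc : 0 < c) (hH : Continuous H) {x : ℝ}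
    (hx : 0 < x) : HasDerivAt (singAverage A B c H)
      ((c + B * x) / (A * x ^ 2) * (H x - singAverage A B c H x)) x := by
  have hcont : ContinuousOn (fun y => singWeight' A B c y * H y) (Ioi 0) := by
    refine ContinuousOn.mul (ContinuousOn.mul ((continuousOn_singWeight hA hB hc).mono
      Ioi_subset_Ici_self) (ContinuousOn.div (by fun_prop) (by fun_prop) fun y hy => ?_))
      hH.continuousOn
    have : 0 < y := hy
    positivity
  have h1 : HasDerivAt (fun x => ∫ y in (0 : ℝ)..x, singWeight' A B c y * H y)
      (singWeight' A B c x * H x) x :=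
    intervalIntegral.integral_hasDerivAt_right
      (intervalIntegrable_singWeight'_mul hA hB hc hH hx.le)
      (hcont.stronglyMeasurableAtFilter isOpen_Ioi x hx) (hcont.continuousAt (Ioi_mem_nhds hx))
  have hp := singWeight_pos (A := A) (B := B) (c := c) hx
  refine ((h1.div (hasDerivAt_singWeight hA hx) hp.ne').congr_of_eventuallyEq ?_).congr_deriv ?_
  · filter_upwards [lt_mem_nhds hx] with z hz using singAverage_of_pos hz
  · rw [singAverage_of_pos hx]
    simp only [singWeight']
    field_simp

theorem continuous_singAverage (hA : 0 < A) (hB : 0 < B) (hc : 0 < c) (hH : Continuous H) :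
    Continuous (singAverage A B c H) := by
  rw [continuous_iff_continuousAt]
  intro x
  rcases lt_trichotomy x 0 with hx | rfl | hx
  · refine (continuousAt_const (y := H 0)).congr ?_
    filter_upwards [gt_mem_nhds hx] with z hz using (singAverage_of_nonpos hz.le).symm
  · rw [Metric.continuousAt_iff]
    intro η hη
    obtain ⟨δ, hδ, h⟩ := Metric.continuousAt_iff.1 (hH.continuousAt (x := 0)) (η / 2) (half_pos hη)
    refine ⟨δ, hδ, fun z hz => ?_⟩
    rw [Real.dist_eq, singAverage_of_nonpos le_rfl]
    rcases le_or_gt z 0 with h0 | h0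
    · rw [singAverage_of_nonpos h0, sub_self, abs_zero]
      exact hη
    · have := abs_singAverage_sub_le hA hB hc hH (continuous_const (y := H 0)) h0.le
        (δ := η / 2) fun y hy => by
          rw [← Real.dist_eq]
          refine (h ?_).le
          rw [Real.dist_eq, sub_zero, abs_of_pos h0] at hz
          rw [Real.dist_eq, sub_zero, abs_of_nonneg hy.1]
          exact hy.2.trans_lt hz
      rw [singAverage_const hA hB hc] at this
      linarith
  · exact (hasDerivAt_singAverage hA hB hc hH hx).continuousAt

/-- The derivative of the bounded solution converges at the singular point. -/
theorem tendsto_deriv_singAverage (hA : 0 < A) (hB : 0 < B) (hc : 0 < c) (hH : Continuous H)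
    {H' : ℝ → ℝ} {v : ℝ} (hH' : ∀ x, 0 < x → HasDerivAt H (H' x) x)
    (hv : Tendsto H' (𝓝[>] 0) (𝓝 v)) :
    Tendsto (fun x => (c + B * x) / (A * x ^ 2) * (H x - singAverage A B c H x)) (𝓝[>] 0)
      (𝓝 v) := by
  have hp0 : Tendsto (singWeight A B c) (𝓝[>] 0) (𝓝 0) := by
    have := (continuousOn_singWeight hA hB hc) 0 self_mem_Ici
    rw [ContinuousWithinAt, singWeight_zero hA hB] at this
    exact this.mono_left (nhdsWithin_mono _ Ioi_subset_Ici_self)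
  -- L'Hôpital after inserting the factor p: the derivative of p(H - g) is just pH', because the
  -- singular terms cancel. The quotient of derivatives is H'/(2x + (c + Bx)/A).
  have hquot : Tendsto (fun x => (singWeight A B c x * (H x - singAverage A B c H x))
      / (x ^ 2 * singWeight A B c x)) (𝓝[>] 0) (𝓝 (v * (A / c))) := by
    refine HasDerivAt.lhopital_zero_nhdsGT (f' := fun x => singWeight A B c x * H' x)
      (g' := fun x => singWeight A B c x * (2 * x + (c + B * x) / A)) ?_ ?_ ?_ ?_ ?_ ?_
    · filter_upwards [self_mem_nhdsWithin] with x hx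
      refine ((hasDerivAt_singWeight hA hx).mul
        ((hH' x hx).sub (hasDerivAt_singAverage hA hB hc hH hx))).congr_deriv ?_
      rw [singWeight', Pi.sub_apply]
      ring
    · filter_upwards [self_mem_nhdsWithin] with x hx
      have hx' : x ≠ 0 := ne_of_gt hx
      refine (((hasDerivAt_pow 2 x)).mul (hasDerivAt_singWeight hA hx)).congr_deriv ?_
      rw [singWeight']
      field_simp
      push_cast
      ring
    · filter_upwards [self_mem_nhdsWithin] with x hx
      have hx' : 0 < x := hx
      have := singWeight_pos (A := A) (B := B) (c := c) hx'
      positivity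
    · have : Tendsto (fun x => H x - singAverage A B c H x) (𝓝[>] 0)
          (𝓝 (H 0 - singAverage A B c H 0)) :=
        ((hH.sub (continuous_singAverage hA hB hc hH)).tendsto 0).mono_left nhdsWithin_le_nhds
      simpa using hp0.mul this
    · have : Tendsto (fun x : ℝ => x ^ 2) (𝓝[>] 0) (𝓝 (0 ^ 2)) :=
        ((continuous_pow 2).tendsto 0).mono_left nhdsWithin_le_nhds
      simpa using this.mul hp0
    · have h1 : Tendsto (fun x : ℝ => 2 * x + (c + B * x) / A) (𝓝[>] 0)
          (𝓝 (2 * 0 + (c + B * 0) / A)) :=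
        ((by fun_prop : Continuous fun x : ℝ => 2 * x + (c + B * x) / A).tendsto 0).mono_left
          nhdsWithin_le_nhds
      have h2 := hv.div h1 (by
        rw [mul_zero, mul_zero, zero_add, add_zero]
        positivity)
      have h3 : v / (2 * 0 + (c + B * 0) / A) = v * (A / c) := by
        rw [mul_zero, mul_zero, zero_add, add_zero]
        field_simp
      rw [h3] at h2
      refine h2.congr' ?_
      filter_upwards [self_mem_nhdsWithin] with x hx
      rw [Pi.div_apply, mul_div_mul_left _ _ (singWeight_pos hx).ne']
  have h1 : Tendsto (fun x : ℝ => (c + B * x) / A) (𝓝[>] 0) (𝓝 ((c + B * 0) / A)) :=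
    ((by fun_prop : Continuous fun x : ℝ => (c + B * x) / A).tendsto 0).mono_left
      nhdsWithin_le_nhds
  have h2 := h1.mul hquot
  have h3 : (c + B * 0) / A * (v * (A / c)) = v := by
    field_simp
    ring
  rw [h3] at h2
  refine h2.congr' ?_
  filter_upwards [self_mem_nhdsWithin] with x hx
  have hx' : x ≠ 0 := ne_of_gt hx
  have := (singWeight_pos (A := A) (B := B) (c := c) hx).ne'
  field_simp

end

/-! ### The solution V_a and its optimality near the origin. -/

namespace SurplusModel

variable {P : SurplusModel}

theorem solvesHJBAt_of_le {W : ℝ → ℝ} {x θ₀ : ℝ} (hθ₀ : θ₀ ∈ Icc (-P.b) P.a)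
    (h0 : P.L θ₀ W x = 0) (h : ∀ θ ∈ Icc (-P.b) P.a, P.L θ W x ≤ 0) :
    P.SolvesHJBAt θ₀ W x := by
  refine ⟨⟨?_, fun u hu => ?_⟩, h0⟩
  · rintro _ ⟨θ, hθ, rfl⟩
    exact h θ hθ
  · rw [← h0]
    exact hu ⟨θ₀, hθ₀, rfl⟩

/-- The operator is quadratic in θ. Once the value at a is 0, the sign of the last factor decides
whether a is optimal. -/
theorem L_sub_L_a (θ : ℝ) (W : ℝ → ℝ) (x : ℝ) : P.L θ W x - P.L P.a W x
    = (θ - P.a) * x * ((θ + P.a) / 2 * (P.σ ^ 2 * x * deriv (deriv W) x)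
      + (P.μ - P.r) * deriv W x) := by
  rw [L, L]
  ring

/-- The constant-proportion solution `V_a` exists. -/
theorem exists_isConstantSolution (hμr : P.r < P.μ) : ∃ Va, P.IsConstantSolution P.a Va := by
  have ha := P.a_pos
  have hσ := P.σ_pos
  have hc := P.c_pos
  have hr := P.r_pos
  have hlam := P.lam_pos
  set A : ℝ := P.σ ^ 2 * P.a ^ 2 / 2 with hAdef
  set B : ℝ := P.r + P.a * (P.μ - P.r) with hBdef
  have hA : 0 < A := by positivity
  have hB : 0 < B := by
    have := mul_pos ha (sub_pos.2 hμr)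
    linarith
  set V : (ℝ → ℝ) → ℝ → ℝ := fun g z => 1 + ∫ t in (0 : ℝ)..z, g t with hVdef
  have hV : ∀ g, Continuous g → ∀ y, HasDerivAt (V g) (g y) y := fun g hg y =>
    (hg.integral_hasStrictDerivAt 0 y).hasDerivAt.const_add 1
  have hVc : ∀ g, Continuous g → Continuous (V g) := fun g hg =>
    continuous_iff_continuousAt.2 fun y => (hV g hg y).continuousAt
  -- With g = V', the equation for V_a is Ax²g' = (c + Bx)(H - g). So g must be a fixed point of
  -- averaging H(g), and no initial slope is imposed: g(0) = H(0) = λ/c results by itself.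
  set H : (ℝ → ℝ) → ℝ → ℝ := fun g y => P.M (V g) (max y 0) / (P.c + B * max y 0) with hHdef
  have hden : ∀ y : ℝ, P.c ≤ P.c + B * max y 0 := fun y => by
    have := mul_nonneg hB.le (le_max_right y 0)
    linarith
  have hH : ∀ g, Continuous g → Continuous (H g) := fun g hg =>
    ((continuousOn_M (hVc g hg)).comp_continuous (by fun_prop)
      fun y => mem_Ici.2 (le_max_right _ _)).div (by fun_prop)
      fun y => (hc.trans_le (hden y)).ne'
  obtain ⟨g, hg, hfix⟩ := exists_volterra_fixedPoint (s := 0)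
    (fun g => singAverage A B P.c (H g))
    (fun g hg => continuous_singAverage hA hB hc (hH g hg)) (fun X => by
      refine ⟨2 * P.lam / P.c, by positivity, fun g₁ g₂ h₁ h₂ x hx => ?_⟩
      refine abs_singAverage_sub_le hA hB hc (hH _ h₁) (hH _ h₂) hx.1 fun y hy => ?_
      simp only [hHdef]
      rw [← sub_div, abs_div, abs_of_pos (hc.trans_le (hden y)), max_eq_left hy.1]
      have h3 : |P.M (V g₁) y - P.M (V g₂) y| ≤ 2 * P.lam * ∫ t in (0 : ℝ)..x, |g₁ t - g₂ t| := by
        refine abs_M_sub_le (hVc _ h₁) (hVc _ h₂) hy.1 fun z hz => ?_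
        have : V g₁ z - V g₂ z = ∫ t in (0 : ℝ)..z, (g₁ t - g₂ t) := by
          rw [intervalIntegral.integral_sub (h₁.intervalIntegrable _ _)
            (h₂.intervalIntegrable _ _)]
          simp only [hVdef]
          ring
        rw [this]
        refine (intervalIntegral.abs_integral_le_integral_abs hz.1).trans ?_
        exact intervalIntegral.integral_mono_interval le_rfl hz.1 (hz.2.trans hy.2)
          (Eventually.of_forall fun t => abs_nonneg _)
          ((h₁.sub h₂).abs.intervalIntegrable _ _)
      calc |P.M (V g₁) y - P.M (V g₂) y| / (P.c + B * y)
          ≤ |P.M (V g₁) y - P.M (V g₂) y| / P.c := by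
            refine div_le_div_of_nonneg_left (abs_nonneg _) hc ?_
            have := mul_nonneg hB.le hy.1
            linarith
        _ ≤ 2 * P.lam * (∫ t in (0 : ℝ)..x, |g₁ t - g₂ t|) / P.c := by gcongr
        _ = _ := by ring)
  set g' : ℝ → ℝ := fun x => (P.c + B * x) / (A * x ^ 2) * (H g x - singAverage A B P.c (H g) x)
    with hg'def
  have hgd : ∀ x, 0 < x → HasDerivAt g (g' x) x := fun x hx => by
    refine (hasDerivAt_singAverage hA hB hc (hH g hg) hx).congr_of_eventuallyEq ?_
    filter_upwards [lt_mem_nhds hx] with z hz using (hfix z hz.le).symm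
  have hg'c : ContinuousOn g' (Ioi 0) := by
    refine ContinuousOn.mul (ContinuousOn.div (by fun_prop) (by fun_prop) fun y hy => ?_)
      ((hH g hg).sub (continuous_singAverage hA hB hc (hH g hg))).continuousOn
    have : 0 < y := hy
    positivity
  have hM0 : P.M (V g) 0 = P.lam := by
    rw [M]
    simp [hVdef]
  have hg0 : g 0 = P.lam / P.c := by
    rw [← hfix 0 le_rfl, singAverage_of_nonpos le_rfl]
    simp only [hHdef]
    rw [max_self, hM0, mul_zero, add_zero]
  have hVd : ∀ x, 0 < x → HasDerivAt (V g) (g x) x := fun x _ => hV g hg x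
  have hderiv : deriv (V g) = g := funext fun x => (hV g hg x).deriv
  refine ⟨V g, contDiffOn_two_Ioi hVd hgd hg'c, fun x hx => ?_, ?_, ?_, ?_⟩
  · rw [L, deriv_deriv_eq_of_Ioi hVd hgd hx, hderiv, hg'def]
    simp only
    rw [hfix x hx.le]
    simp only [hHdef, max_eq_left hx.le]
    have : 0 < P.c + B * x := by positivity
    field_simp
    rw [hAdef, hBdef]
    ring
  · have := ((hVc g hg).tendsto 0).mono_left (nhdsWithin_le_nhds (s := Ioi 0))
    simpa [hVdef] using this
  · rw [hderiv, ← hg0]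
    exact (hg.tendsto 0).mono_left nhdsWithin_le_nhds
  · have hd := P.continuous_dens
    set M' : ℝ → ℝ := fun x => P.lam * (g x - (V g 0 * P.dens x
      + ∫ s in (0 : ℝ)..x, g (x - s) * P.dens s)) with hM'def
    have hM'c : Continuous M' := by
      refine continuous_const.mul (hg.sub ((continuous_const.mul hd).add ?_))
      exact intervalIntegral.continuous_parametric_intervalIntegral_of_continuous
        (f := fun x s => g (x - s) * P.dens s) (by simp only [Function.uncurry_def]; fun_prop)
        continuous_id
    have hHd : ∀ x, 0 < x → HasDerivAt (H g)
        ((M' x * (P.c + B * x) - P.M (V g) x * B) / (P.c + B * x) ^ 2) x := fun x hx => by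
      have h1 : HasDerivAt (fun x => P.c + B * x) B x := by
        simpa using ((hasDerivAt_id x).const_mul B).const_add P.c
      refine ((hasDerivAt_M hg (hV g hg) hx).div h1 (by positivity)).congr_of_eventuallyEq ?_
      filter_upwards [lt_mem_nhds hx] with z hz
      simp only [hHdef, max_eq_left hz.le, Pi.div_apply]
    have hlim : Tendsto (fun x => (M' x * (P.c + B * x) - P.M (V g) x * B) / (P.c + B * x) ^ 2)
        (𝓝[>] 0) (𝓝 ((M' 0 * (P.c + B * 0) - P.M (V g) 0 * B) / (P.c + B * 0) ^ 2)) := by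
      have h1 : Tendsto M' (𝓝[>] 0) (𝓝 (M' 0)) := (hM'c.tendsto 0).mono_left nhdsWithin_le_nhds
      have h2 : Tendsto (fun x => P.c + B * x) (𝓝[>] 0) (𝓝 (P.c + B * 0)) :=
        ((by fun_prop : Continuous fun x => P.c + B * x).tendsto 0).mono_left nhdsWithin_le_nhds
      have h3 : Tendsto (P.M (V g)) (𝓝[>] 0) (𝓝 (P.M (V g) 0)) :=
        ((continuousOn_M (hVc g hg)) 0 self_mem_Ici).mono_left
          (nhdsWithin_mono _ Ioi_subset_Ici_self)
      exact ((h1.mul h2).sub (h3.mul_const B)).div (h2.pow 2) (by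
        rw [mul_zero, add_zero]
        positivity)
    have hfin := tendsto_deriv_singAverage hA hB hc (hH g hg) hHd hlim
    -- The limit of V'' at 0+ is H'(0+); the quotient rule yields the prescribed value.
    have hval : (M' 0 * (P.c + B * 0) - P.M (V g) 0 * B) / (P.c + B * 0) ^ 2
        = P.lam / P.c * (P.lam / P.c - P.f 0 - (P.r + P.a * (P.μ - P.r)) / P.c) := by
      rw [hM0, ← hBdef]
      simp only [hM'def, hg0, hVdef, intervalIntegral.integral_same, dens_of_nonneg le_rfl]
      field_simp
      ring
    rw [hval] at hfin
    refine hfin.congr' ?_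
    filter_upwards [self_mem_nhdsWithin] with x hx
    exact (deriv_deriv_eq_of_Ioi hVd hgd hx).symm

/-- Near the origin the constant proportion `a` is optimal for `V_a`. -/
theorem IsConstantSolution.exists_solvesHJB (hμr : P.r < P.μ) (hab : P.b ≤ P.a) {Va : ℝ → ℝ}
    (h : P.IsConstantSolution P.a Va) :
    ∃ ε, 0 < ε ∧ ∀ x, 0 < x → x < ε → P.SolvesHJBAt P.a Va x := by
  have ha := P.a_pos
  have hb := P.b_pos
  have hm : 0 < P.μ - P.r := sub_pos.2 hμr
  -- Near 0 the second-order term xV_a'' tends to 0 while V_a' tends to λ/c > 0, so the first-order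
  -- term decides the sign.
  have hlim : Tendsto (fun x => (P.μ - P.r) * deriv Va x
      - P.a * |P.σ ^ 2 * x * deriv (deriv Va) x|) (𝓝[>] 0)
      (𝓝 ((P.μ - P.r) * (P.lam / P.c) - P.a * |P.σ ^ 2 * 0 * (P.lam / P.c *
        (P.lam / P.c - P.f 0 - (P.r + P.a * (P.μ - P.r)) / P.c))|)) := by
    have hx : Tendsto (fun x : ℝ => P.σ ^ 2 * x) (𝓝[>] 0) (𝓝 (P.σ ^ 2 * 0)) :=
      ((continuous_const.mul continuous_id).tendsto 0).mono_left nhdsWithin_le_nhds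
    exact (h.lim_one.const_mul _).sub (((hx.mul h.lim_two).abs).const_mul _)
  have hpos : 0 < (P.μ - P.r) * (P.lam / P.c) - P.a * |P.σ ^ 2 * 0 * (P.lam / P.c *
        (P.lam / P.c - P.f 0 - (P.r + P.a * (P.μ - P.r)) / P.c))| := by
    rw [mul_zero, zero_mul, abs_zero, mul_zero, sub_zero]
    exact mul_pos hm (div_pos P.lam_pos P.c_pos)
  obtain ⟨ε, hε, hε'⟩ := mem_nhdsGT_iff_exists_Ioo_subset.1 (hlim.eventually (lt_mem_nhds hpos))
  refine ⟨ε, hε, fun x hx hxε => ?_⟩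
  have hxp : 0 < (P.μ - P.r) * deriv Va x - P.a * |P.σ ^ 2 * x * deriv (deriv Va) x| :=
    hε' ⟨hx, hxε⟩
  refine solvesHJBAt_of_le ⟨by linarith, le_rfl⟩ (h.eq_zero x hx) fun θ hθ => ?_
  have h1 := P.L_sub_L_a θ Va x
  rw [h.eq_zero x hx, sub_zero] at h1
  rw [h1]
  refine mul_nonpos_of_nonpos_of_nonneg
    (mul_nonpos_of_nonpos_of_nonneg (by linarith [hθ.2]) hx.le) ?_
  have h2 : |(θ + P.a) / 2 * (P.σ ^ 2 * x * deriv (deriv Va) x)|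
      ≤ P.a * |P.σ ^ 2 * x * deriv (deriv Va) x| := by
    rw [abs_mul]
    refine mul_le_mul_of_nonneg_right ?_ (abs_nonneg _)
    exact abs_le.2 ⟨by linarith [hθ.1], by linarith [hθ.2]⟩
  linarith [(abs_le.1 h2).1]

/-- Optimality of `a` on `(0, ε)` persists at `ε` and means that `σ² a x V_a'' + (μ - r) V_a' ≥ 0`. -/
theorem IsConstantSolution.nonneg_of_solvesHJB {Va : ℝ → ℝ} (h : P.IsConstantSolution P.a Va)
    {ε : ℝ} (hH : ∀ x, 0 < x → x < ε → P.SolvesHJBAt P.a Va x) {x : ℝ} (hx : 0 < x)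
    (hxε : x ≤ ε) :
    0 ≤ P.a * (P.σ ^ 2 * x * deriv (deriv Va) x) + (P.μ - P.r) * deriv Va x := by
  have ha := P.a_pos
  have hb := P.b_pos
  obtain ⟨hd1, hd2, hd3⟩ := h.smooth.derivs_of_Ioi
  have key : ∀ y ∈ Ioo 0 ε,
      0 ≤ P.a * (P.σ ^ 2 * y * deriv (deriv Va) y) + (P.μ - P.r) * deriv Va y := by
    intro y hy
    -- Divide the inequality for θ < a by (θ - a)y < 0 and let θ increase to a.
    have hlim : Tendsto (fun θ => (θ + P.a) / 2 * (P.σ ^ 2 * y * deriv (deriv Va) y)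
        + (P.μ - P.r) * deriv Va y) (𝓝[<] P.a)
        (𝓝 ((P.a + P.a) / 2 * (P.σ ^ 2 * y * deriv (deriv Va) y) + (P.μ - P.r) * deriv Va y)) :=
      ((by fun_prop : Continuous fun θ => (θ + P.a) / 2 * (P.σ ^ 2 * y * deriv (deriv Va) y)
        + (P.μ - P.r) * deriv Va y).tendsto _).mono_left nhdsWithin_le_nhds
    rw [add_self_div_two] at hlim
    refine ge_of_tendsto hlim ?_
    filter_upwards [Ioo_mem_nhdsLT (show -P.b < P.a by linarith)] with θ hθ
    have h1 := P.L_sub_L_a θ Va y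
    rw [h.eq_zero y hy.1, sub_zero] at h1
    have h2 := (hH y hy.1 hy.2).1.1 ⟨θ, ⟨hθ.1.le, hθ.2.le⟩, rfl⟩
    simp only at h2
    rw [h1] at h2
    exact nonneg_of_mul_nonpos_right h2 (mul_neg_of_neg_of_pos (by linarith [hθ.2]) hy.1)
  have hcont : ContinuousOn (fun y => P.a * (P.σ ^ 2 * y * deriv (deriv Va) y)
      + (P.μ - P.r) * deriv Va y) (Ioi 0) := by
    have h1 : ContinuousOn (deriv Va) (Ioi 0) := fun y hy =>
      (hd2 y hy).continuousAt.continuousWithinAt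
    fun_prop
  have hlim : Tendsto (fun y => P.a * (P.σ ^ 2 * y * deriv (deriv Va) y)
      + (P.μ - P.r) * deriv Va y) (𝓝[<] x)
      (𝓝 (P.a * (P.σ ^ 2 * x * deriv (deriv Va) x) + (P.μ - P.r) * deriv Va x)) :=
    ((hcont.continuousAt (Ioi_mem_nhds hx)).tendsto).mono_left nhdsWithin_le_nhds
  refine ge_of_tendsto hlim ?_
  filter_upwards [Ioo_mem_nhdsLT hx] with y hy
  exact key y ⟨hy.1, hy.2.trans_le hxε⟩

end SurplusModel

/-! ### Solutions with cut-off on the half line, and gluing at ε. -/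

/-- A function that is positive at `0` and increasing at each first zero is positive. -/
theorem pos_of_deriv_pos_of_first_zero {g g' : ℝ → ℝ} {X : ℝ} (hg : Continuous g) (h0 : 0 < g 0)
    (hd : ∀ x, 0 < x → x ≤ X → HasDerivAt g (g' x) x)
    (hz : ∀ x, 0 < x → x ≤ X → (∀ y, 0 ≤ y → y < x → 0 < g y) → g x = 0 → 0 < g' x) :
    ∀ x, 0 ≤ x → x ≤ X → 0 < g x := by
  by_contra! hcon
  obtain ⟨x₁, hx₁, hx₁X, hgx₁⟩ := hcon
  set S : Set ℝ := Ici 0 ∩ g ⁻¹' Iic 0 with hS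
  have hSc : IsClosed S := isClosed_Ici.inter (isClosed_Iic.preimage hg)
  have hSb : BddBelow S := ⟨0, fun y hy => hy.1⟩
  have hSn : S.Nonempty := ⟨x₁, hx₁, hgx₁⟩
  set x₀ := sInf S with hx₀
  have hx₀S : x₀ ∈ S := hSc.csInf_mem hSn hSb
  have hlt : ∀ y, 0 ≤ y → y < x₀ → 0 < g y := fun y hy hyx => by
    by_contra! hgy
    exact absurd (csInf_le hSb ⟨hy, hgy⟩) (not_le.2 hyx)
  have hx₀0 : 0 < x₀ := by
    refine lt_of_le_of_ne hx₀S.1 fun h => ?_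
    have : g x₀ ≤ 0 := hx₀S.2
    rw [← h] at this
    linarith
  have hx₀X : x₀ ≤ X := (csInf_le hSb ⟨hx₁, hgx₁⟩).trans hx₁X
  have hev : ∀ᶠ y in 𝓝[<] x₀, 0 < g y := by
    filter_upwards [Ioo_mem_nhdsLT hx₀0] with y hy using hlt y hy.1.le hy.2
  have hgx₀ : g x₀ = 0 := by
    refine le_antisymm hx₀S.2 ?_
    exact ge_of_tendsto ((hg.tendsto x₀).mono_left nhdsWithin_le_nhds)
      (hev.mono fun y hy => hy.le)
  have hpos := hz x₀ hx₀0 hx₀X hlt hgx₀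
  have hslope := (hasDerivAt_iff_tendsto_slope.1 (hd x₀ hx₀0 hx₀X)).mono_left
    (nhdsWithin_mono x₀ (s := Iio x₀) fun y hy => ne_of_lt hy)
  have hle : g' x₀ ≤ 0 := by
    refine le_of_tendsto hslope ?_
    filter_upwards [hev, self_mem_nhdsWithin] with y hy hyx
    rw [slope_def_field, hgx₀]
    have : y < x₀ := hyx
    exact div_nonpos_of_nonneg_of_nonpos (by linarith) (by linarith)
  linarith

namespace SurplusModel

variable (P : SurplusModel)

/-- `M(W)(x) - (c + r x) g(x)`, where `g` stands for `W'`. -/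
def excess (W g : ℝ → ℝ) (x : ℝ) : ℝ := P.M W x - (P.c + P.r * x) * g x

/-- `(μ - r) x g(x)`. -/
def riskGain (g : ℝ → ℝ) (x : ℝ) : ℝ := (P.μ - P.r) * x * g x

/-- `W` is a function with derivative `g`, normalized at `0`, that solves the optimality equation
on `(0, ∞)` with cut-off `A`. -/
structure IsCutoffSolution (A : ℝ) (W g : ℝ → ℝ) : Prop where
  cont : Continuous g
  deriv : ∀ x, HasDerivAt W (g x) x
  zero : W 0 = 1
  init : g 0 = P.lam / P.c
  eq : ∀ x, 0 < x → HasDerivAt g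
    (2 / (P.σ ^ 2 * x ^ 2) * P.cutInf A (P.excess W g x) (P.riskGain g x)) x

variable {P}

theorem le_of_deriv_nonneg {W g : ℝ → ℝ} (hW : ∀ x, HasDerivAt W (g x) x) {x : ℝ}
    (hg : ∀ y, 0 ≤ y → y < x → 0 ≤ g y) {y z : ℝ} (hy : 0 ≤ y) (hyz : y ≤ z) (hz : z ≤ x) :
    W y ≤ W z := by
  have hmono : MonotoneOn W (Icc 0 x) := by
    refine monotoneOn_of_deriv_nonneg (convex_Icc 0 x)
      (fun t _ => (hW t).continuousAt.continuousWithinAt)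
      (fun t _ => (hW t).differentiableAt.differentiableWithinAt) fun t ht => ?_
    rw [interior_Icc] at ht
    rw [(hW t).deriv]
    exact hg t ht.1.le ht.2
  exact hmono ⟨hy, hyz.trans hz⟩ ⟨hy.trans hyz, hz⟩ hyz

theorem tail_le_M {W g : ℝ → ℝ} (hW : ∀ x, HasDerivAt W (g x) x) (h0 : W 0 = 1) {x : ℝ}
    (hx : 0 ≤ x) (hg : ∀ y, 0 ≤ y → y < x → 0 ≤ g y) :
    P.lam * (1 - ∫ s in (0 : ℝ)..x, P.dens s) ≤ P.M W x := by
  have hWc : Continuous W := continuous_iff_continuousAt.2 fun y => (hW y).continuousAt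
  refine le_trans ?_ (M_ge hWc hx fun y hy => le_of_deriv_nonneg hW hg hy.1 hy.2 le_rfl)
  refine mul_le_mul_of_nonneg_left ?_ P.lam_pos.le
  refine le_mul_of_one_le_right (by linarith [P.integral_dens_lt_one hx]) ?_
  rw [← h0]
  exact le_of_deriv_nonneg hW hg le_rfl hx le_rfl

theorem M_pos {W g : ℝ → ℝ} (hW : ∀ x, HasDerivAt W (g x) x) (h0 : W 0 = 1) {x : ℝ}
    (hx : 0 ≤ x) (hg : ∀ y, 0 ≤ y → y < x → 0 ≤ g y) : 0 < P.M W x :=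
  (mul_pos P.lam_pos (by linarith [P.integral_dens_lt_one hx])).trans_le (tail_le_M hW h0 hx hg)

section

variable {A : ℝ} {W g : ℝ → ℝ}

/-- At a first zero of g the term E vanishes, while D = M(W) > 0 because W has been increasing up to
there; hence g' ≥ 2D/(σ²x²a²) > 0. -/
theorem IsCutoffSolution.pos (h : P.IsCutoffSolution A W g) (hab : P.b ≤ P.a) (hA : 0 < A)
    (hAa : A < P.a) {x : ℝ} (hx : 0 ≤ x) : 0 < g x := by
  refine pos_of_deriv_pos_of_first_zero h.cont ?_ (fun y hy _ => h.eq y hy)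
    (fun y hy _ hpos hgy => ?_) x hx le_rfl
  · rw [h.init]
    exact div_pos P.lam_pos P.c_pos
  · have hM := M_pos (P := P) h.deriv h.zero hy.le fun z hz hzy => (hpos z hz hzy).le
    have h1 := div_sq_le_cutInf_zero (P := P) hA hAa hab hM.le
    rw [excess, riskGain, hgy, mul_zero, sub_zero, mul_zero]
    have hσ := P.σ_pos
    have ha := P.a_pos
    exact mul_pos (by positivity) ((by positivity : 0 < P.M W y / P.a ^ 2).trans_le h1)

theorem IsCutoffSolution.mono (h : P.IsCutoffSolution A W g) (hab : P.b ≤ P.a) (hA : 0 < A)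
    (hAa : A < P.a) {x y : ℝ} (hx : 0 ≤ x) (hxy : x ≤ y) : W x ≤ W y :=
  le_of_deriv_nonneg h.deriv (fun _ hz _ => (h.pos hab hA hAa hz).le) hx hxy le_rfl

theorem IsCutoffSolution.one_le (h : P.IsCutoffSolution A W g) (hab : P.b ≤ P.a) (hA : 0 < A)
    (hAa : A < P.a) {x : ℝ} (hx : 0 ≤ x) : 1 ≤ W x :=
  h.zero.symm.trans_le (IsCutoffSolution.mono (x := 0) (y := x) h hab hA hAa le_rfl hx)

theorem IsCutoffSolution.continuous (h : P.IsCutoffSolution A W g) : Continuous W :=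
  continuous_iff_continuousAt.2 fun y => (h.deriv y).continuousAt

theorem continuousOn_excess (hW : Continuous W) (hg : Continuous g) :
    ContinuousOn (P.excess W g) (Ici 0) :=
  (continuousOn_M hW).sub (by fun_prop)

theorem continuous_riskGain (hg : Continuous g) : Continuous (P.riskGain g) := by
  unfold riskGain
  fun_prop

theorem continuousOn_rhs (hA : 0 < A) (hAa : A < P.a) (hW : Continuous W) (hg : Continuous g) :
    ContinuousOn (fun x => 2 / (P.σ ^ 2 * x ^ 2) *
      P.cutInf A (P.excess W g x) (P.riskGain g x)) (Ioi 0) := by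
  refine ContinuousOn.mul (ContinuousOn.div (by fun_prop) (by fun_prop) fun y hy => ?_) ?_
  · have : 0 < y := hy
    have := P.σ_pos
    positivity
  · have h : ContinuousOn (fun x => (P.excess W g x, P.riskGain g x)) (Ioi 0) :=
      ContinuousOn.prodMk ((continuousOn_excess hW hg).mono Ioi_subset_Ici_self)
        (continuous_riskGain hg).continuousOn
    have h2 := Continuous.comp_continuousOn' (continuous_cutInf (P := P) hA hAa) h
    exact h2

end

/-- The function `V_a` as a `C¹` function on the line, with the properties used to extend it. -/
theorem IsConstantSolution.exists_extension (hμr : P.r < P.μ) (hab : P.b ≤ P.a) {Va : ℝ → ℝ}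
    (h : P.IsConstantSolution P.a Va) {ε : ℝ}
    (hH : ∀ x, 0 < x → x < ε → P.SolvesHJBAt P.a Va x) :
    ∃ V g : ℝ → ℝ, Continuous g ∧ (∀ x, HasDerivAt V (g x) x) ∧ V 0 = 1 ∧ g 0 = P.lam / P.c ∧
      (∀ x, 0 < x → V x = Va x) ∧ (∀ x, 0 < x → g x = deriv Va x) ∧
      (∀ x, 0 < x → HasDerivAt g (deriv (deriv Va) x) x) ∧
      (∀ x, 0 ≤ x → x ≤ ε → 0 < g x) ∧
      (∀ x, 0 < x → x ≤ ε → P.a * P.riskGain g x ≤ 2 * P.excess V g x) ∧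
      ∀ A, 0 < A → A < P.a → ∀ x, 0 < x → x ≤ ε → deriv (deriv Va) x
        = 2 / (P.σ ^ 2 * x ^ 2) * P.cutInf A (P.excess V g x) (P.riskGain g x) := by
  have ha := P.a_pos
  have hσ := P.σ_pos
  have hm : 0 < P.μ - P.r := sub_pos.2 hμr
  obtain ⟨hd1, hd2, -⟩ := h.smooth.derivs_of_Ioi
  obtain ⟨V, g, hg, hV, hV0, hg0, hVeq, hgeq⟩ := exists_C1_extension hd1
    (fun x hx => (hd2 x hx).continuousAt.continuousWithinAt) h.lim_zero h.lim_one
  have hgd : ∀ x, 0 < x → HasDerivAt g (deriv (deriv Va) x) x := fun x hx => by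
    refine (hd2 x hx).congr_of_eventuallyEq ?_
    filter_upwards [lt_mem_nhds hx] with z hz using hgeq z hz
  have hL : ∀ x, 0 < x → P.σ ^ 2 * x ^ 2 * P.a ^ 2 / 2 * deriv (deriv Va) x
      = P.excess V g x - P.a * P.riskGain g x := fun x hx => by
    have h1 := h.eq_zero x hx
    rw [L, ← hgeq x hx, ← M_congr hx fun y hy _ => hVeq y hy] at h1
    rw [excess, riskGain]
    linear_combination h1
  have hpos : ∀ x, 0 ≤ x → x ≤ ε → 0 < g x := by
    refine pos_of_deriv_pos_of_first_zero hg ?_ (fun y hy _ => hgd y hy)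
      (fun y hy _ hpos hgy => ?_)
    · rw [hg0]
      exact div_pos P.lam_pos P.c_pos
    · have hM := M_pos (P := P) hV hV0 hy.le fun z hz hzy => (hpos z hz hzy).le
      have h1 := hL y hy
      rw [excess, riskGain, hgy, mul_zero, sub_zero, mul_zero, mul_zero, sub_zero] at h1
      exact pos_of_mul_pos_right (h1 ▸ hM) (by positivity)
  -- Combined with the equation for V_a, optimality of a is the statement φ ≥ a. The infimum is then
  -- attained at a for every cut-off, so V_a solves all the cut-off equations on (0, ε].
  have hge : ∀ x, 0 < x → x ≤ ε → P.a * P.riskGain g x ≤ 2 * P.excess V g x := by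
    intro x hx hxε
    have h1 := h.nonneg_of_solvesHJB hH hx hxε
    rw [← hgeq x hx] at h1
    have h2 := mul_nonneg (mul_pos ha hx).le h1
    have h3 := hL x hx
    have h4 : P.riskGain g x = (P.μ - P.r) * x * g x := rfl
    rw [h4] at h3 ⊢
    nlinarith
  refine ⟨V, g, hg, hV, hV0, hg0, hVeq, hgeq, hgd, hpos, hge, fun A hA hAa x hx hxε => ?_⟩
  have hE : 0 < P.riskGain g x := mul_pos (mul_pos hm hx) (hpos x hx.le hxε)
  rw [cutInf_eq_of_ge hA hAa hab hE (hge x hx hxε)]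
  have h3 := hL x hx
  field_simp
  field_simp at h3
  linear_combination h3

/-- An extension of `V_a` beyond `ε` solves the optimality equation on the whole half line. -/
theorem IsExtension.exists_cutoffSolution (hμr : P.r < P.μ) (hab : P.b ≤ P.a) {Va : ℝ → ℝ}
    (h : P.IsConstantSolution P.a Va) {ε : ℝ} (hε : 0 < ε)
    (hH : ∀ x, 0 < x → x < ε → P.SolvesHJBAt P.a Va x) {A : ℝ} (hA : 0 < A) (hAa : A < P.a)
    {V : ℝ → ℝ} (hext : P.IsExtension Va ε A V) :
    ∃ W g : ℝ → ℝ, P.IsCutoffSolution A W g ∧ (∀ x, 0 < x → W x = V x) ∧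
      (∀ x, 0 < x → x ≤ ε → W x = Va x ∧ g x = deriv Va x) ∧
      ∀ x, 0 < x → x ≤ ε → P.a * P.riskGain g x ≤ 2 * P.excess W g x := by
  obtain ⟨U, k, hk, hU, hU0, hk0, hUeq, hkeq, hkd, -, hge, heq⟩ := h.exists_extension hμr hab hH
  obtain ⟨hVle, w, hw, hwε, hVw, hwd⟩ := hext
  set g : ℝ → ℝ := fun x => k (min x ε) + (w (max x ε) - w ε) with hgdef
  have hgc : Continuous g := by
    refine (hk.comp (by fun_prop)).add (Continuous.sub ?_ continuous_const)
    exact hw.continuousOn.comp_continuous (by fun_prop) fun x => mem_Ici.2 (le_max_right _ _)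
  have hgle : ∀ x, x ≤ ε → g x = k x := fun x hx => by
    simp only [hgdef, min_eq_left hx, max_eq_right hx, sub_self, add_zero]
  have hgge : ∀ x, ε ≤ x → g x = w x := fun x hx => by
    simp only [hgdef, min_eq_right hx, max_eq_left hx]
    rw [hkeq ε hε, hwε]
    ring
  have hW : ∀ x, HasDerivAt (fun x => 1 + ∫ t in (0 : ℝ)..x, g t) (g x) x := fun x =>
    (hgc.integral_hasStrictDerivAt 0 x).hasDerivAt.const_add 1
  set W : ℝ → ℝ := fun x => 1 + ∫ t in (0 : ℝ)..x, g t with hWdef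
  have hWle : ∀ x, 0 ≤ x → x ≤ ε → W x = U x := fun x hx hxε => by
    simp only [hWdef]
    have h1 : ∫ t in (0 : ℝ)..x, g t = ∫ t in (0 : ℝ)..x, k t :=
      intervalIntegral.integral_congr fun t ht => by
        rw [uIcc_of_le hx] at ht
        exact hgle t (ht.2.trans hxε)
    rw [h1, intervalIntegral.integral_eq_sub_of_hasDerivAt (fun t _ => hU t)
      (hk.intervalIntegrable _ _), hU0]
    ring
  have hWV : ∀ x, 0 < x → W x = V x := by
    intro x hx
    rcases le_total x ε with hxε | hxε
    · rw [hWle x hx.le hxε, hVle x hx hxε, hUeq x hx]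
    · rw [hVw x hxε, ← hUeq ε hε, ← hWle ε hε.le le_rfl]
      simp only [hWdef]
      rw [← intervalIntegral.integral_add_adjacent_intervals (hgc.intervalIntegrable 0 ε)
        (hgc.intervalIntegrable ε x), add_assoc]
      congr 2
      refine intervalIntegral.integral_congr fun t ht => ?_
      rw [uIcc_of_le hxε] at ht
      exact hgge t ht.1
  have hexc : ∀ x, 0 < x → x ≤ ε → P.excess W g x = P.excess U k x := fun x hx hxε => by
    rw [excess, excess, hgle x hxε,
      M_congr hx fun y hy hyx => hWle y hy.le (hyx.trans hxε)]
  have hrg : ∀ x, x ≤ ε → P.riskGain g x = P.riskGain k x := fun x hxε => by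
    rw [riskGain, riskGain, hgle x hxε]
  have hleft : ∀ x, 0 < x → x ≤ ε → HasDerivWithinAt g
      (2 / (P.σ ^ 2 * x ^ 2) * P.cutInf A (P.excess W g x) (P.riskGain g x)) (Iic ε) x := by
    intro x hx hxε
    rw [hexc x hx hxε, hrg x hxε, ← heq A hA hAa x hx hxε]
    exact (hkd x hx).hasDerivWithinAt.congr (fun y hy => hgle y hy) (hgle x hxε)
  have hright : ∀ x, ε ≤ x → HasDerivWithinAt g
      (2 / (P.σ ^ 2 * x ^ 2) * P.cutInf A (P.excess W g x) (P.riskGain g x)) (Ici ε) x := by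
    intro x hxε
    have hx : 0 < x := hε.trans_le hxε
    have h1 := hwd x hxε
    rw [T_eq hA V w hx, ← M_congr hx fun y hy _ => hWV y hy, ← hgge x hxε] at h1
    exact h1.congr (fun y hy => hgge y hy) (hgge x hxε)
  refine ⟨W, g, ⟨hgc, hW, by simp [hWdef], ?_, fun x hx => ?_⟩, hWV, fun x hx hxε => ⟨?_, ?_⟩, ?_⟩
  · rw [hgle 0 hε.le, hk0]
  · rcases lt_trichotomy x ε with hxε | rfl | hxε
    · exact (hleft x hx hxε.le).hasDerivAt (Iic_mem_nhds hxε)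
    -- At ε both one-sided derivatives equal the same right-hand side, so the glued function is
    -- differentiable there.
    · have := (hleft x hx le_rfl).union (hright x le_rfl)
      rw [Iic_union_Ici] at this
      exact hasDerivWithinAt_univ.1 this
    · exact (hright x hxε.le).hasDerivAt (Ici_mem_nhds hxε)
  · rw [hWle x hx.le hxε, hUeq x hx]
  · rw [hgle x hxε, hkeq x hx]
  · intro x hx hxε
    rw [hrg x hxε, hexc x hx hxε]
    exact hge x hx hxε

end SurplusModel

/-! ### Existence and uniqueness for the equation with cut-off. -/

namespace SurplusModel

variable (P : SurplusModel)

/-- The right-hand side of the optimality equation with cut-off `A`. -/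
def rhs (A : ℝ) (W g : ℝ → ℝ) (x : ℝ) : ℝ :=
  2 / (P.σ ^ 2 * x ^ 2) * P.cutInf A (P.excess W g x) (P.riskGain g x)

variable {P} {A : ℝ}

/-- Starting at ε > 0 bounds the factor 1/x². The dependence on g is local; W enters through its
past by way of M. -/
theorem abs_rhs_sub_le (hμr : P.r < P.μ) (hA : 0 < A) (hAa : A < P.a) {ε X y η : ℝ} (hε : 0 < ε)
    (hy : ε ≤ y) (hyX : y ≤ X) {W₁ W₂ g₁ g₂ : ℝ → ℝ} (h₁ : Continuous W₁) (h₂ : Continuous W₂)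
    (hη : ∀ z ∈ Icc 0 y, |W₁ z - W₂ z| ≤ η) :
    |P.rhs A W₁ g₁ y - P.rhs A W₂ g₂ y| ≤
      2 / (P.σ ^ 2 * ε ^ 2) * ((P.c + P.r * X) / A ^ 2 + (P.μ - P.r) * X / A) * |g₁ y - g₂ y|
        + 2 / (P.σ ^ 2 * ε ^ 2) * (2 * P.lam / A ^ 2) * η := by
  have hσ := P.σ_pos
  have hc := P.c_pos
  have hr := P.r_pos
  have hm : 0 < P.μ - P.r := sub_pos.2 hμr
  have hy0 : 0 < y := hε.trans_le hy
  have hM := abs_M_sub_le (P := P) h₁ h₂ hy0.le hη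
  have hD : |P.excess W₁ g₁ y - P.excess W₂ g₂ y|
      ≤ 2 * P.lam * η + (P.c + P.r * X) * |g₁ y - g₂ y| := by
    have : P.excess W₁ g₁ y - P.excess W₂ g₂ y
        = (P.M W₁ y - P.M W₂ y) - (P.c + P.r * y) * (g₁ y - g₂ y) := by
      rw [excess, excess]
      ring
    rw [this]
    refine (abs_sub _ _).trans (add_le_add hM ?_)
    rw [abs_mul, abs_of_pos (by positivity : 0 < P.c + P.r * y)]
    gcongr
  have hE : |P.riskGain g₁ y - P.riskGain g₂ y| ≤ (P.μ - P.r) * X * |g₁ y - g₂ y| := by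
    rw [riskGain, riskGain, ← mul_sub, abs_mul, abs_of_pos (mul_pos hm hy0)]
    gcongr
  have hN := abs_cutInf_sub_le (P := P) (D := P.excess W₁ g₁ y) (E := P.riskGain g₁ y)
    (D' := P.excess W₂ g₂ y) (E' := P.riskGain g₂ y) hA hAa
  rw [rhs, rhs, ← mul_sub, abs_mul, abs_of_pos (by positivity : 0 < 2 / (P.σ ^ 2 * y ^ 2))]
  calc 2 / (P.σ ^ 2 * y ^ 2) * |P.cutInf A (P.excess W₁ g₁ y) (P.riskGain g₁ y)
        - P.cutInf A (P.excess W₂ g₂ y) (P.riskGain g₂ y)|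
      ≤ 2 / (P.σ ^ 2 * ε ^ 2) * ((2 * P.lam * η + (P.c + P.r * X) * |g₁ y - g₂ y|) / A ^ 2
        + (P.μ - P.r) * X * |g₁ y - g₂ y| / A) := by
        refine mul_le_mul (by gcongr) (hN.trans (by gcongr)) (abs_nonneg _) (by positivity)
    _ = _ := by ring

theorem continuous_rhs_max (hA : 0 < A) (hAa : A < P.a) {ε : ℝ} (hε : 0 < ε) {W g : ℝ → ℝ}
    (hW : Continuous W) (hg : Continuous g) : Continuous fun x => P.rhs A W g (max x ε) :=
  (continuousOn_rhs hA hAa hW hg).comp_continuous (by fun_prop)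
    fun x => mem_Ioi.2 (hε.trans_le (le_max_right _ _))

/-- The Volterra estimate behind existence and uniqueness for the optimality equation. -/
theorem exists_integral_rhs_sub_le (hμr : P.r < P.μ) (hA : 0 < A) (hAa : A < P.a) {ε : ℝ}
    (hε : 0 < ε) (X : ℝ) : ∃ K, 0 ≤ K ∧ ∀ W₁ W₂ g₁ g₂ : ℝ → ℝ, Continuous W₁ → Continuous W₂ →
      Continuous g₁ → Continuous g₂ → ∀ x ∈ Icc ε X,
      (∀ z ∈ Icc 0 x, |W₁ z - W₂ z| ≤ ∫ y in ε..x, |g₁ y - g₂ y|) →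
      |∫ y in ε..x, (P.rhs A W₁ g₁ (max y ε) - P.rhs A W₂ g₂ (max y ε))|
        ≤ K * ∫ y in ε..x, |g₁ y - g₂ y| := by
  have hσ := P.σ_pos
  have hc := P.c_pos
  have hr := P.r_pos
  have hlam := P.lam_pos
  have hm : 0 < P.μ - P.r := sub_pos.2 hμr
  have hX' : X ≤ |X| := le_abs_self X
  set C₁ := 2 / (P.σ ^ 2 * ε ^ 2) * ((P.c + P.r * |X|) / A ^ 2 + (P.μ - P.r) * |X| / A)
  set C₂ := 2 / (P.σ ^ 2 * ε ^ 2) * (2 * P.lam / A ^ 2)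
  have hC₁ : 0 ≤ C₁ := by positivity
  have hC₂ : 0 ≤ C₂ := by positivity
  refine ⟨C₁ + C₂ * |X|, by positivity, fun W₁ W₂ g₁ g₂ hW₁ hW₂ hg₁ hg₂ x hx hz => ?_⟩
  set e := ∫ y in ε..x, |g₁ y - g₂ y| with he
  have he0 : 0 ≤ e := intervalIntegral.integral_nonneg hx.1 fun _ _ => abs_nonneg _
  have hd : Continuous fun y => |g₁ y - g₂ y| := (hg₁.sub hg₂).abs
  calc |∫ y in ε..x, (P.rhs A W₁ g₁ (max y ε) - P.rhs A W₂ g₂ (max y ε))|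
      ≤ ∫ y in ε..x, |P.rhs A W₁ g₁ (max y ε) - P.rhs A W₂ g₂ (max y ε)| :=
        intervalIntegral.abs_integral_le_integral_abs hx.1
    _ ≤ ∫ y in ε..x, (C₁ * |g₁ y - g₂ y| + C₂ * e) := by
        refine intervalIntegral.integral_mono_on hx.1
          (((continuous_rhs_max hA hAa hε hW₁ hg₁).sub
            (continuous_rhs_max hA hAa hε hW₂ hg₂)).abs.intervalIntegrable _ _)
          ((by fun_prop : Continuous fun y => C₁ * |g₁ y - g₂ y| + C₂ * e
            ).intervalIntegrable _ _) fun y hy => ?_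
        rw [max_eq_left hy.1]
        exact abs_rhs_sub_le hμr hA hAa hε hy.1 ((hy.2.trans hx.2).trans hX') hW₁ hW₂
          fun z hz' => hz z ⟨hz'.1, hz'.2.trans hy.2⟩
    _ = C₁ * e + (x - ε) * (C₂ * e) := by
        rw [intervalIntegral.integral_add ((hd.intervalIntegrable _ _).const_mul _)
          intervalIntegrable_const, intervalIntegral.integral_const_mul,
          intervalIntegral.integral_const, smul_eq_mul]
    _ ≤ C₁ * e + |X| * (C₂ * e) := by
        have : x - ε ≤ |X| := by linarith [hx.2]
        gcongr
    _ = _ := by ring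

theorem exists_isExtension (hμr : P.r < P.μ) (hab : P.b ≤ P.a) {Va : ℝ → ℝ}
    (h : P.IsConstantSolution P.a Va) {ε : ℝ} (hε : 0 < ε)
    (hH : ∀ x, 0 < x → x < ε → P.SolvesHJBAt P.a Va x) (hA : 0 < A) (hAa : A < P.a) :
    ∃ V, P.IsExtension Va ε A V := by
  obtain ⟨U, k, hk, hU, -, -, hUeq, hkeq, -⟩ := h.exists_extension hμr hab hH
  have hUc : Continuous U := continuous_iff_continuousAt.2 fun y => (hU y).continuousAt
  set G : (ℝ → ℝ) → ℝ → ℝ := fun w y => U (min y ε) + ∫ t in ε..max y ε, w t with hG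
  have hGc : ∀ w, Continuous w → Continuous (G w) := fun w hw => by
    refine (hUc.comp (by fun_prop)).add ?_
    have : Continuous fun x => ∫ t in ε..x, w t :=
      continuous_iff_continuousAt.2 fun x =>
        (hw.integral_hasStrictDerivAt ε x).hasDerivAt.continuousAt
    exact this.comp (by fun_prop)
  have hGz : ∀ w₁ w₂, Continuous w₁ → Continuous w₂ → ∀ x, ε ≤ x → ∀ z ∈ Icc 0 x,
      |G w₁ z - G w₂ z| ≤ ∫ t in ε..x, |w₁ t - w₂ t| := fun w₁ w₂ h₁ h₂ x hx z hz => by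
    have : G w₁ z - G w₂ z = ∫ t in ε..max z ε, (w₁ t - w₂ t) := by
      rw [intervalIntegral.integral_sub (h₁.intervalIntegrable _ _) (h₂.intervalIntegrable _ _)]
      simp only [hG]
      ring
    rw [this]
    refine (intervalIntegral.abs_integral_le_integral_abs (le_max_right _ _)).trans ?_
    exact intervalIntegral.integral_mono_interval le_rfl (le_max_right _ _) (max_le hz.2 hx)
      (Eventually.of_forall fun t => abs_nonneg _) ((h₁.sub h₂).abs.intervalIntegrable _ _)
  set Φ : (ℝ → ℝ) → ℝ → ℝ := fun w x => k ε + ∫ y in ε..x, P.rhs A (G w) w (max y ε) with hΦ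
  have hrc : ∀ w, Continuous w → Continuous fun y => P.rhs A (G w) w (max y ε) := fun w hw =>
    continuous_rhs_max hA hAa hε (hGc w hw) hw
  have hΦd : ∀ w, Continuous w → ∀ x, HasDerivAt (Φ w) (P.rhs A (G w) w (max x ε)) x :=
    fun w hw x => ((hrc w hw).integral_hasStrictDerivAt ε x).hasDerivAt.const_add _
  obtain ⟨w, hw, hfix⟩ := exists_volterra_fixedPoint (s := ε) Φ
    (fun w hw => continuous_iff_continuousAt.2 fun x => (hΦd w hw x).continuousAt) (fun X => by
      obtain ⟨K, hK0, hK⟩ := exists_integral_rhs_sub_le hμr hA hAa hε X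
      refine ⟨K, hK0, fun w₁ w₂ h₁ h₂ x hx => ?_⟩
      have := hK (G w₁) (G w₂) w₁ w₂ (hGc _ h₁) (hGc _ h₂) h₁ h₂ x hx (hGz w₁ w₂ h₁ h₂ x hx.1)
      rw [intervalIntegral.integral_sub ((hrc _ h₁).intervalIntegrable _ _)
        ((hrc _ h₂).intervalIntegrable _ _)] at this
      simp only [hΦ]
      rwa [add_sub_add_left_eq_sub])
  have hGle : ∀ x, x ≤ ε → G w x = U x := fun x hx => by
    simp only [hG, min_eq_left hx, max_eq_right hx, intervalIntegral.integral_same, add_zero]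
  -- The derivative offered is Φ w rather than w: the two agree only on [ε, ∞), but Φ w is C¹ on the
  -- whole line.
  refine ⟨G w, fun x hx hxε => ?_, Φ w, ?_, ?_, fun x hx => ?_, fun x hx => ?_⟩
  · rw [hGle x hxε, hUeq x hx]
  · refine ContDiff.contDiffOn (contDiff_one_iff_deriv.2
      ⟨fun x => (hΦd w hw x).differentiableAt, ?_⟩)
    rw [show deriv (Φ w) = _ from funext fun x => (hΦd w hw x).deriv]
    exact hrc w hw
  · rw [← hkeq ε hε]
    simp [hΦ]
  · rw [← hUeq ε hε]
    simp only [hG, min_eq_right hx, max_eq_left hx]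
    congr 1
    refine intervalIntegral.integral_congr fun t ht => ?_
    rw [uIcc_of_le hx] at ht
    exact (hfix t ht.1).symm
  · rw [T_eq hA _ _ (hε.trans_le hx), hfix x hx]
    have := hΦd w hw x
    rw [max_eq_left hx] at this
    exact this.hasDerivWithinAt

/-- Two solutions of the optimality equation that agree up to `ε` agree. -/
theorem eqOn_of_hasDerivAt_rhs (hμr : P.r < P.μ) (hA : 0 < A) (hAa : A < P.a) {ε X : ℝ}
    (hε : 0 < ε) {W₁ W₂ g₁ g₂ : ℝ → ℝ} (hg₁ : Continuous g₁) (hg₂ : Continuous g₂)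
    (hW₁ : ∀ x, HasDerivAt W₁ (g₁ x) x) (hW₂ : ∀ x, HasDerivAt W₂ (g₂ x) x) (h0 : W₁ 0 = W₂ 0)
    (hle : ∀ x, 0 ≤ x → x ≤ ε → g₁ x = g₂ x)
    (hd₁ : ∀ x ∈ Icc ε X, HasDerivAt g₁ (P.rhs A W₁ g₁ x) x)
    (hd₂ : ∀ x ∈ Icc ε X, HasDerivAt g₂ (P.rhs A W₂ g₂ x) x) :
    ∀ x, 0 ≤ x → x ≤ X → W₁ x = W₂ x := by
  have hc₁ : Continuous W₁ := continuous_iff_continuousAt.2 fun y => (hW₁ y).continuousAt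
  have hc₂ : Continuous W₂ := continuous_iff_continuousAt.2 fun y => (hW₂ y).continuousAt
  have hsub : ∀ y, W₁ y - W₂ y = ∫ t in (0 : ℝ)..y, (g₁ t - g₂ t) := fun y => by
    rw [intervalIntegral.integral_eq_sub_of_hasDerivAt
      (fun t _ => (hW₁ t).sub (hW₂ t)) ((hg₁.sub hg₂).intervalIntegrable _ _)]
    simp [h0]
  have habs : Continuous fun t => |g₁ t - g₂ t| := (hg₁.sub hg₂).abs
  have hz : ∀ x, ε ≤ x → ∀ z ∈ Icc 0 x, |W₁ z - W₂ z| ≤ ∫ t in ε..x, |g₁ t - g₂ t| := by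
    intro x hx z hz
    have h1 : ∫ t in (0 : ℝ)..ε, |g₁ t - g₂ t| = 0 := by
      rw [intervalIntegral.integral_congr (g := fun _ => 0) fun t ht => ?_]
      · simp
      · rw [uIcc_of_le hε.le] at ht
        simp [hle t ht.1 ht.2]
    have h2 : ∫ t in ε..x, |g₁ t - g₂ t| = ∫ t in (0 : ℝ)..x, |g₁ t - g₂ t| := by
      rw [← intervalIntegral.integral_add_adjacent_intervals (habs.intervalIntegrable 0 ε)
        (habs.intervalIntegrable ε x), h1, zero_add]
    rw [hsub, h2]
    refine (intervalIntegral.abs_integral_le_integral_abs hz.1).trans ?_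
    exact intervalIntegral.integral_mono_interval le_rfl hz.1 hz.2
      (Eventually.of_forall fun t => abs_nonneg _) (habs.intervalIntegrable _ _)
  obtain ⟨K, -, hK⟩ := exists_integral_rhs_sub_le hμr hA hAa hε X
  have hzero := eq_zero_of_abs_le_integral (d := fun t => g₁ t - g₂ t) (hg₁.sub hg₂)
    (s := ε) (X := X) (K := K) fun x hx => by
      have hr₁ := continuous_rhs_max hA hAa hε hc₁ hg₁
      have hr₂ := continuous_rhs_max hA hAa hε hc₂ hg₂
      have h1 := intervalIntegral.integral_eq_sub_of_hasDerivAt (a := ε) (b := x)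
        (f := fun t => g₁ t - g₂ t)
        (f' := fun y => P.rhs A W₁ g₁ (max y ε) - P.rhs A W₂ g₂ (max y ε)) (fun t ht => by
          rw [uIcc_of_le hx.1] at ht
          rw [max_eq_left ht.1]
          exact (hd₁ t ⟨ht.1, ht.2.trans hx.2⟩).sub (hd₂ t ⟨ht.1, ht.2.trans hx.2⟩))
        ((hr₁.sub hr₂).intervalIntegrable _ _)
      rw [hle ε hε.le le_rfl, sub_self, sub_zero] at h1
      rw [← h1]
      exact hK W₁ W₂ g₁ g₂ hc₁ hc₂ hg₁ hg₂ x hx (hz x hx.1)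
  intro x hx hxX
  have : ∫ t in (0 : ℝ)..x, (g₁ t - g₂ t) = ∫ t in (0 : ℝ)..x, (0 : ℝ) := by
    refine intervalIntegral.integral_congr fun t ht => ?_
    rw [uIcc_of_le hx] at ht
    rcases le_total t ε with htε | htε
    · exact sub_eq_zero.2 (hle t ht.1 htε)
    · exact hzero t ⟨htε, ht.2.trans hxX⟩
  have h2 := hsub x
  rw [this, intervalIntegral.integral_zero] at h2
  exact sub_eq_zero.1 h2

end SurplusModel

/-! ### Comparison principles and bounds independent of the cut-off. -/

theorem le_mul_exp_of_deriv_le {u u' : ℝ → ℝ} {s X K v : ℝ}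
    (hu : ∀ x ∈ Icc s X, HasDerivAt u (u' x) x) (hv : 0 < v) (hs : u s ≤ v)
    (hK : ∀ x ∈ Icc s X, u' x ≤ K * u x) :
    ∀ x ∈ Icc s X, u x ≤ v * Real.exp ((K + 1) * (x - s)) := by
  refine image_le_of_deriv_right_lt_deriv_boundary
    (fun x hx => (hu x hx).continuousAt.continuousWithinAt)
    (fun x hx => (hu x ⟨hx.1, hx.2.le⟩).hasDerivWithinAt)
    (B' := fun x => (K + 1) * (v * Real.exp ((K + 1) * (x - s)))) (by simpa using hs)
    (fun x => ?_) fun x hx hux => ?_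
  · refine ((((hasDerivAt_id x).sub_const s).const_mul (K + 1)).exp.const_mul v).congr_deriv ?_
    simp only [id]
    ring
  · have h1 := hK x ⟨hx.1, hx.2.le⟩
    have h2 := mul_pos hv (Real.exp_pos ((K + 1) * (x - s)))
    rw [hux] at h1
    linarith

/-- The barrier lies in (0, v], so the differential inequality is needed only for such values of u.
The rate K + 1 makes the comparison strict at a point of contact. -/
theorem mul_exp_le_of_le_deriv {u u' : ℝ → ℝ} {s X K v : ℝ}
    (hu : ∀ x ∈ Icc s X, HasDerivAt u (u' x) x) (hv : 0 < v) (hs : v ≤ u s) (hK0 : 0 ≤ K)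
    (hK : ∀ x ∈ Icc s X, u x ≤ v → 0 < u x → -(K * u x) ≤ u' x) :
    ∀ x ∈ Icc s X, v * Real.exp (-(K + 1) * (x - s)) ≤ u x := by
  have hneg := image_le_of_deriv_right_lt_deriv_boundary (f := fun x => -u x)
    (f' := fun x => -u' x) (a := s) (b := X)
    (fun x hx => (hu x hx).continuousAt.neg.continuousWithinAt)
    (fun x hx => (hu x ⟨hx.1, hx.2.le⟩).neg.hasDerivWithinAt)
    (B := fun x => -(v * Real.exp (-(K + 1) * (x - s))))
    (B' := fun x => (K + 1) * (v * Real.exp (-(K + 1) * (x - s)))) (by simpa using hs)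
    (fun x => by
      refine ((((hasDerivAt_id x).sub_const s).const_mul
        (-(K + 1))).exp.const_mul v).neg.congr_deriv ?_
      simp only [id]
      ring) (fun x hx hux => by
      have h2 := mul_pos hv (Real.exp_pos (-(K + 1) * (x - s)))
      have hux' : u x = v * Real.exp (-(K + 1) * (x - s)) := neg_injective hux
      have h3 : u x ≤ v := by
        rw [hux']
        refine mul_le_of_le_one_right hv.le (Real.exp_le_one_iff.2 ?_)
        nlinarith [hx.1]
      have h1 := hK x ⟨hx.1, hx.2.le⟩ h3 (hux' ▸ h2)
      rw [← hux']
      rw [← hux'] at h2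
      linarith)
  intro x hx
  exact neg_le_neg_iff.1 (hneg hx)

theorem const_le_of_deriv_pos {u u' : ℝ → ℝ} {s X v : ℝ}
    (hu : ∀ x ∈ Icc s X, HasDerivAt u (u' x) x) (hs : v ≤ u s)
    (hK : ∀ x ∈ Icc s X, u x = v → 0 < u' x) : ∀ x ∈ Icc s X, v ≤ u x := by
  have hneg := image_le_of_deriv_right_lt_deriv_boundary (f := fun x => -u x)
    (f' := fun x => -u' x) (a := s) (b := X)
    (fun x hx => (hu x hx).continuousAt.neg.continuousWithinAt)
    (fun x hx => (hu x ⟨hx.1, hx.2.le⟩).neg.hasDerivWithinAt)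
    (B := fun _ => -v) (B' := fun _ => 0) (by simpa using hs)
    (fun x => hasDerivAt_const x _) (fun x hx hux => by
      have := hK x ⟨hx.1, hx.2.le⟩ (neg_injective hux)
      linarith)
  intro x hx
  exact neg_le_neg_iff.1 (hneg hx)

namespace SurplusModel

variable {P : SurplusModel} {A : ℝ} {W g : ℝ → ℝ}

theorem riskGain_pos (hμr : P.r < P.μ) {x : ℝ} (hx : 0 < x) (hg : 0 < g x) :
    0 < P.riskGain g x :=
  mul_pos (mul_pos (sub_pos.2 hμr) hx) hg

theorem IsCutoffSolution.nonneg (h : P.IsCutoffSolution A W g) (hab : P.b ≤ P.a) (hA : 0 < A)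
    (hAa : A < P.a) {x : ℝ} (hx : 0 ≤ x) : 0 ≤ W x :=
  zero_le_one.trans (h.one_le hab hA hAa hx)

theorem IsCutoffSolution.M_le (h : P.IsCutoffSolution A W g) (hab : P.b ≤ P.a) (hA : 0 < A)
    (hAa : A < P.a) {x : ℝ} (hx : 0 ≤ x) : P.M W x ≤ P.lam * W x :=
  SurplusModel.M_le hx fun _ hy => h.nonneg hab hA hAa hy.1

/-- An upper bound for the derivative of a solution that does not depend on the cut-off. -/
theorem IsCutoffSolution.exists_upper_bound (P : SurplusModel) (hμr : P.r < P.μ)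
    (hab : P.b ≤ P.a) {ε w₀ g₀ : ℝ} (hε : 0 < ε) (hw₀ : 0 < w₀) (hg₀ : 0 < g₀) (X : ℝ) :
    ∃ G, 0 < G ∧ ∀ A W g, 0 < A → A < P.a → P.IsCutoffSolution A W g → W ε = w₀ → g ε = g₀ →
      ∀ x ∈ Icc ε X, g x ≤ G := by
  have ha := P.a_pos
  have hσ := P.σ_pos
  have hlam := P.lam_pos
  have hc := P.c_pos
  have hr := P.r_pos
  set K := 1 + 2 * P.lam / (P.σ ^ 2 * ε ^ 2 * P.a ^ 2) with hKdef
  have hK : 0 < K := by positivity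
  refine ⟨(w₀ + g₀) * Real.exp ((K + 1) * |X - ε|), by positivity,
    fun A W g hA hAa h hWε hgε x hx => ?_⟩
  have hder : ∀ x ∈ Icc ε X, HasDerivAt (fun x => W x + g x) (g x + P.rhs A W g x) x :=
    fun x hx => (h.deriv x).add (h.eq x (hε.trans_le hx.1))
  -- Testing θ = a and dropping the negative terms gives g' ≤ const · W with a constant free of A;
  -- adding W' = g closes the inequality for W + g.
  have h1 := le_mul_exp_of_deriv_le hder (v := w₀ + g₀) (K := K) (by positivity)
    (by rw [hWε, hgε]) (fun y hy => by
      have hy0 : 0 < y := hε.trans_le hy.1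
      have hgy := h.pos hab hA hAa hy0.le
      have hWy := h.nonneg hab hA hAa hy0.le
      have hN : P.cutInf A (P.excess W g y) (P.riskGain g y) ≤ P.lam * W y / P.a ^ 2 := by
        refine (cutInf_le hA ⟨by linarith [P.b_pos], le_rfl⟩
          (by rwa [abs_of_pos ha])).trans ?_
        have h2 : 0 ≤ P.riskGain g y / P.a := (div_pos (riskGain_pos hμr hy0 hgy) ha).le
        have h3 : P.excess W g y ≤ P.lam * W y := by
          have h4 := h.M_le hab hA hAa hy0.le
          have : 0 ≤ (P.c + P.r * y) * g y := by positivity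
          rw [excess]
          linarith
        have h5 : P.excess W g y / P.a ^ 2 ≤ P.lam * W y / P.a ^ 2 := by gcongr
        linarith
      have hR : P.rhs A W g y ≤ 2 / (P.σ ^ 2 * ε ^ 2) * (P.lam * W y / P.a ^ 2) := by
        rw [rhs]
        have hyε := hy.1
        calc 2 / (P.σ ^ 2 * y ^ 2) * P.cutInf A (P.excess W g y) (P.riskGain g y)
            ≤ 2 / (P.σ ^ 2 * y ^ 2) * (P.lam * W y / P.a ^ 2) := by gcongr
          _ ≤ _ := by gcongr
      have h6 : 2 / (P.σ ^ 2 * ε ^ 2) * (P.lam * W y / P.a ^ 2)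
          = 2 * P.lam / (P.σ ^ 2 * ε ^ 2 * P.a ^ 2) * W y := by
        field_simp
      have h7 : 0 ≤ 2 * P.lam / (P.σ ^ 2 * ε ^ 2 * P.a ^ 2) := by positivity
      rw [h6] at hR
      rw [hKdef]
      nlinarith [mul_nonneg h7 hgy.le]) x hx
  have h2 : W x + g x ≤ (w₀ + g₀) * Real.exp ((K + 1) * |X - ε|) := by
    refine h1.trans ?_
    have : x - ε ≤ |X - ε| := (by linarith [hx.2] : x - ε ≤ X - ε).trans (le_abs_self _)
    gcongr
  linarith [h.nonneg hab hA hAa (hε.le.trans hx.1)]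

/-- A positive lower bound for the derivative of a solution that does not depend on the
cut-off. -/
theorem IsCutoffSolution.exists_lower_bound (P : SurplusModel) (hμr : P.r < P.μ)
    (hab : P.b ≤ P.a) {ε g₀ X : ℝ} (hε : 0 < ε) (hg₀ : 0 < g₀) (hX : ε ≤ X) :
    ∃ l, 0 < l ∧ ∀ A W g, 0 < A → A < P.a → P.IsCutoffSolution A W g → g ε = g₀ →
      ∀ x ∈ Icc ε X, l ≤ g x := by
  have hσ := P.σ_pos
  have hc := P.c_pos
  have hr := P.r_pos
  have hm : 0 < P.μ - P.r := sub_pos.2 hμr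
  have hX0 : 0 < X := hε.trans_le hX
  set δ := P.lam * (1 - ∫ s in (0 : ℝ)..X, P.dens s) with hδdef
  have hδ : 0 < δ := mul_pos P.lam_pos (by linarith [P.integral_dens_lt_one hX0.le])
  -- On [ε, X] one has M(W) ≥ δ, so g ≤ v forces D ≥ δ/2. The completed square then gives g' ≥ -(μ -
  -- r)²g²/(σ²δ) ≥ -Kg.
  set v := min g₀ (δ / (2 * (P.c + P.r * X))) with hvdef
  have hv : 0 < v := lt_min hg₀ (by positivity)
  set K := (P.μ - P.r) ^ 2 * v / (P.σ ^ 2 * δ) with hKdef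
  have hK : 0 < K := by positivity
  refine ⟨v * Real.exp (-(K + 1) * (X - ε)), by positivity, fun A W g hA hAa h hgε x hx => ?_⟩
  have h1 := mul_exp_le_of_le_deriv (fun x hx => h.eq x (hε.trans_le hx.1)) hv
    (hgε ▸ min_le_left _ _) hK.le (fun y hy hyv hgy => by
      have hy0 : 0 < y := hε.trans_le hy.1
      have hM : δ ≤ P.M W y := by
        refine le_trans ?_ (tail_le_M h.deriv h.zero hy0.le
          fun z hz _ => (h.pos hab hA hAa hz).le)
        refine mul_le_mul_of_nonneg_left ?_ P.lam_pos.le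
        linarith [P.integral_dens_mono hy0.le hy.2]
      have hD : δ / 2 ≤ P.excess W g y := by
        have h2 : (P.c + P.r * y) * g y ≤ (P.c + P.r * X) * (δ / (2 * (P.c + P.r * X))) := by
          have := hy.2
          have := hyv.trans (min_le_right _ _)
          gcongr
        have h3 : (P.c + P.r * X) * (δ / (2 * (P.c + P.r * X))) = δ / 2 := by
          field_simp
        rw [excess]
        linarith
      have hN := neg_sq_div_le_cutInf (P := P) (E := P.riskGain g y) hA hAa
        ((half_pos hδ).trans_le hD)
      have h4 : P.riskGain g y ^ 2 / (4 * P.excess W g y) ≤ P.riskGain g y ^ 2 / (4 * (δ / 2)) := by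
        gcongr
      have h5 : -(P.riskGain g y ^ 2 / (4 * (δ / 2)))
          ≤ P.cutInf A (P.excess W g y) (P.riskGain g y) := by linarith
      have h6 : 2 / (P.σ ^ 2 * y ^ 2) * -(P.riskGain g y ^ 2 / (4 * (δ / 2)))
          = -((P.μ - P.r) ^ 2 * g y / (P.σ ^ 2 * δ) * g y) := by
        rw [riskGain]
        field_simp
        ring
      calc -(K * g y) ≤ -((P.μ - P.r) ^ 2 * g y / (P.σ ^ 2 * δ) * g y) := by
            rw [hKdef]
            gcongr
        _ = 2 / (P.σ ^ 2 * y ^ 2) * -(P.riskGain g y ^ 2 / (4 * (δ / 2))) := h6.symm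
        _ ≤ _ := by gcongr) x hx
  refine le_trans ?_ h1
  have hxX := hx.2
  rw [neg_mul, neg_mul]
  gcongr

/-- A positive lower bound for `φ` on `[ε, X]`, valid for all small cut-offs. -/
theorem IsCutoffSolution.exists_phi_bound (P : SurplusModel) (hμr : P.r < P.μ)
    (hab : P.b ≤ P.a) {ε X w₀ g₀ d₀ G₀ : ℝ} (hε : 0 < ε) (hX : ε ≤ X) (hw₀ : 0 < w₀)
    (hg₀ : 0 < g₀) (hd₀ : 0 < d₀) :
    ∃ δ, 0 < δ ∧ δ < P.a ∧ ∀ A W g, 0 < A → A < δ → P.IsCutoffSolution A W g → W ε = w₀ →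
      g ε = g₀ → d₀ ≤ P.excess W g ε → (∀ x, 0 ≤ x → x ≤ ε → g x ≤ G₀) →
      ∀ x ∈ Icc ε X, δ * P.riskGain g x ≤ 2 * P.excess W g x := by
  have ha := P.a_pos
  have hσ := P.σ_pos
  have hc := P.c_pos
  have hr := P.r_pos
  have hlam := P.lam_pos
  have hm : 0 < P.μ - P.r := sub_pos.2 hμr
  have hX0 : 0 < X := hε.trans_le hX
  obtain ⟨G₁, hG₁, hup⟩ := IsCutoffSolution.exists_upper_bound P hμr hab hε hw₀ hg₀ X
  obtain ⟨l, hl, hlow⟩ := IsCutoffSolution.exists_lower_bound P hμr hab hε hg₀ hX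
  obtain ⟨F, hF⟩ := (isCompact_Icc (a := (0 : ℝ)) (b := X)).exists_bound_of_continuousOn
    P.continuous_dens.continuousOn
  have hF0 : 0 ≤ F := (norm_nonneg _).trans (hF 0 ⟨le_rfl, hX0.le⟩)
  set G := max G₀ G₁ with hGdef
  have hG : 0 < G := hG₁.trans_le (le_max_right _ _)
  -- The part of D' not involving g' is at least -C. The choice of θ makes -cg' ≥ C + 1 when θ is
  -- tested at a point with φ ≤ θ.
  set C := P.lam * (F + G) + P.r * G with hCdef
  have hC : 0 < C := by positivity
  set θ := min (P.a / 2) (P.c * (P.μ - P.r) * l / (P.σ ^ 2 * X * (C + 1))) with hθdef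
  have hθ : 0 < θ := lt_min (by positivity) (by positivity)
  have hθa : θ < P.a := (min_le_left _ _).trans_lt (by linarith)
  -- The level d is so low that D = d implies D ≤ Eθ/2, that is, φ ≤ θ; it also lies below the
  -- initial value of D.
  set d := min d₀ ((P.μ - P.r) * ε * l * θ / 2) with hddef
  have hd : 0 < d := lt_min hd₀ (by positivity)
  refine ⟨min θ (2 * d / ((P.μ - P.r) * X * G₁)), lt_min hθ (by positivity),
    (min_le_left _ _).trans_lt hθa, fun A W g hA hAδ h hWε hgε hdε hgG x hx => ?_⟩
  have hAθ : A < θ := hAδ.trans_le (min_le_left _ _)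
  have hAa : A < P.a := hAθ.trans hθa
  have hgle : ∀ y, 0 ≤ y → y ≤ X → |g y| ≤ G := fun y hy hyX => by
    rw [abs_of_pos (h.pos hab hA hAa hy)]
    rcases le_total y ε with hyε | hyε
    · exact (hgG y hy hyε).trans (le_max_left _ _)
    · exact (hup A W g hA hAa h hWε hgε y ⟨hyε, hyX⟩).trans (le_max_right _ _)
  have hder : ∀ y ∈ Icc ε X, HasDerivAt (P.excess W g)
      (P.lam * (g y - (W 0 * P.dens y + ∫ s in (0 : ℝ)..y, g (y - s) * P.dens s))
        - (P.r * g y + (P.c + P.r * y) * P.rhs A W g y)) y := fun y hy => by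
    have hy0 : 0 < y := hε.trans_le hy.1
    have h1 : HasDerivAt (fun y => P.c + P.r * y) P.r y := by
      simpa using ((hasDerivAt_id y).const_mul P.r).const_add P.c
    exact (hasDerivAt_M h.cont h.deriv hy0).sub (h1.mul (h.eq y hy0))
  -- At the level d, the admissible θ > A gives an infimum of at most -E/(2θ), whence D' ≥ 1: the
  -- level cannot be crossed downwards.
  have hD : ∀ y ∈ Icc ε X, d ≤ P.excess W g y := by
    refine const_le_of_deriv_pos hder ((min_le_left _ _).trans hdε) fun y hy hyd => ?_
    have hy0 : 0 < y := hε.trans_le hy.1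
    have hgy := h.pos hab hA hAa hy0.le
    have hgl := hlow A W g hA hAa h hgε y hy
    have hgG' := (le_abs_self _).trans (hgle y hy0.le hy.2)
    have hI := abs_integral_mul_dens_le (P := P) h.cont hy0.le
      (fun z hz => hgle z hz.1 (hz.2.trans hy.2))
    have hI' := (abs_le.1 hI).2
    have hFy := (le_abs_self _).trans (hF y ⟨hy0.le, hy.2⟩)
    have hM' : -(P.lam * (F + G))
        ≤ P.lam * (g y - (W 0 * P.dens y + ∫ s in (0 : ℝ)..y, g (y - s) * P.dens s)) := by
      rw [h.zero, one_mul, ← mul_neg]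
      refine mul_le_mul_of_nonneg_left ?_ hlam.le
      linarith
    have hE : (P.μ - P.r) * ε * l ≤ P.riskGain g y := by
      have := hy.1
      rw [riskGain]
      gcongr
    have hdE : P.excess W g y ≤ P.riskGain g y * θ / 2 := by
      rw [hyd]
      refine (min_le_right _ _).trans ?_
      gcongr
    have hN : P.cutInf A (P.excess W g y) (P.riskGain g y) ≤ -(P.riskGain g y / (2 * θ)) := by
      refine (cutInf_le hA (θ := θ) ⟨by linarith [P.b_pos], hθa.le⟩
        (by rwa [abs_of_pos hθ])).trans ?_
      have h2 : P.excess W g y / θ ^ 2 ≤ P.riskGain g y * θ / 2 / θ ^ 2 := by gcongr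
      have h3 : P.riskGain g y * θ / 2 / θ ^ 2 - P.riskGain g y / θ
          = -(P.riskGain g y / (2 * θ)) := by
        field_simp
        ring
      linarith
    have hR : P.rhs A W g y ≤ -((P.μ - P.r) * l / (P.σ ^ 2 * X * θ)) := by
      rw [rhs]
      have h2 : 2 / (P.σ ^ 2 * y ^ 2) * -(P.riskGain g y / (2 * θ))
          = -((P.μ - P.r) * g y / (P.σ ^ 2 * y * θ)) := by
        rw [riskGain]
        field_simp
      have h3 : (P.μ - P.r) * l / (P.σ ^ 2 * X * θ) ≤ (P.μ - P.r) * g y / (P.σ ^ 2 * y * θ) := by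
        have := hy.2
        gcongr
      calc 2 / (P.σ ^ 2 * y ^ 2) * P.cutInf A (P.excess W g y) (P.riskGain g y)
          ≤ 2 / (P.σ ^ 2 * y ^ 2) * -(P.riskGain g y / (2 * θ)) := by gcongr
        _ ≤ _ := by linarith
    have hθ2 : C + 1 ≤ P.c * ((P.μ - P.r) * l / (P.σ ^ 2 * X * θ)) := by
      have h2 : θ ≤ P.c * (P.μ - P.r) * l / (P.σ ^ 2 * X * (C + 1)) := min_le_right _ _
      rw [le_div_iff₀ (by positivity)] at h2
      rw [mul_div_assoc', le_div_iff₀ (by positivity)]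
      linarith
    have hR0 : 0 ≤ -P.rhs A W g y := by
      have : 0 < (P.μ - P.r) * l / (P.σ ^ 2 * X * θ) := by positivity
      linarith
    have h8 : P.c * ((P.μ - P.r) * l / (P.σ ^ 2 * X * θ))
        ≤ (P.c + P.r * y) * -P.rhs A W g y := by
      refine mul_le_mul ?_ (by linarith) (by positivity) (by positivity)
      have : 0 ≤ P.r * y := by positivity
      linarith
    have h9 : P.r * g y ≤ P.r * G := by gcongr
    linarith
  have hx0 : 0 < x := hε.trans_le hx.1
  have hgx := h.pos hab hA hAa hx0.le
  have hE : P.riskGain g x ≤ (P.μ - P.r) * X * G₁ := by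
    have := hx.2
    have := hup A W g hA hAa h hWε hgε x hx
    rw [riskGain]
    gcongr
  calc min θ (2 * d / ((P.μ - P.r) * X * G₁)) * P.riskGain g x
      ≤ 2 * d / ((P.μ - P.r) * X * G₁) * ((P.μ - P.r) * X * G₁) :=
        mul_le_mul (min_le_right _ _) hE (riskGain_pos hμr hx0 hgx).le (by positivity)
    _ = 2 * d := by field_simp
    _ ≤ _ := by linarith [hD x hx]

end SurplusModel

/-! ### Pointwise optimality, stabilization of the V^(n), and the limit. -/

namespace SurplusModel

variable {P : SurplusModel}

theorem cutInf_eq_cutInf {A₁ A₂ D E : ℝ} (hab : P.b ≤ P.a) (h₁ : 0 < A₁) (h₁a : A₁ < P.a)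
    (h₂ : 0 < A₂) (h₂a : A₂ < P.a) (hE : 0 < E) (h₁E : A₁ * E < 2 * D) (h₂E : A₂ * E < 2 * D) :
    P.cutInf A₁ D E = P.cutInf A₂ D E := by
  rcases le_total (2 * D) (P.a * E) with h | h
  · rw [cutInf_eq_of_le h₁ h₁a hE h₁E h, cutInf_eq_of_le h₂ h₂a hE h₂E h]
  · rw [cutInf_eq_of_ge h₁ h₁a hab hE h, cutInf_eq_of_ge h₂ h₂a hab hE h]

/-- The conclusions at a point where the equation with a cut-off below `φ` holds. -/
theorem optimality_at (hμr : P.r < P.μ) (hab : P.b ≤ P.a) {A x : ℝ} {V : ℝ → ℝ} (hx : 0 < x)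
    (hA : 0 < A) (hAa : A < P.a) (hV : 0 < deriv V x)
    (hAE : A * P.riskGain (deriv V) x < 2 * P.excess V (deriv V) x)
    (hV2 : deriv (deriv V) x = P.rhs A V (deriv V) x) :
    (P.phi V x < P.a → deriv (deriv V) x ≠ 0 ∧ P.SolvesHJBAt (P.alpha V x) V x) ∧
    (P.a < P.phi V x → P.SolvesHJBAt P.a V x) ∧
    0 < P.phi V x ∧
    (P.phi V x < P.a → P.alphaStar V x = P.alpha V x ∧ P.alpha V x = P.phi V x) ∧
    (P.a ≤ P.phi V x → P.alphaStar V x = P.a) ∧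
    P.alphaStar V x ∈ Icc (-P.b) P.a ∧
    P.SolvesHJBAt (P.alphaStar V x) V x ∧
    (∀ θ ∈ Icc (-P.b) P.a, P.L θ V x = 0 → θ = P.alphaStar V x) := by
  have ha := P.a_pos
  have hb := P.b_pos
  have hσ := P.σ_pos
  have hm : 0 < P.μ - P.r := sub_pos.2 hμr
  have hE := riskGain_pos hμr hx hV
  set D := P.excess V (deriv V) x with hDdef
  set E := P.riskGain (deriv V) x with hEdef
  have hphi : P.phi V x = 2 * D / E := rfl
  have hD : 0 < D := by nlinarith [mul_pos hA hE]
  have hL : ∀ θ, P.L θ V x = P.σ ^ 2 * x ^ 2 * θ ^ 2 / 2 * deriv (deriv V) x + E * θ - D :=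
    fun θ => by
      rw [L, hDdef, hEdef, excess, riskGain]
      ring
  have halpha : P.alpha V x = -E / (P.σ ^ 2 * x ^ 2 * deriv (deriv V) x) := by
    rw [alpha, hEdef, riskGain, show -((P.μ - P.r) * x * deriv V x)
      = x * -((P.μ - P.r) * deriv V x) by ring,
      show P.σ ^ 2 * x ^ 2 * deriv (deriv V) x = x * (P.σ ^ 2 * x * deriv (deriv V) x) by ring,
      mul_div_mul_left _ _ hx.ne']
  rw [hphi, div_lt_iff₀ hE, lt_div_iff₀ hE, le_div_iff₀ hE]
  have hφ0 : 0 < 2 * D / E := by positivity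
  rcases le_or_gt (2 * D) (P.a * E) with hle | hgt
  · have hV2' : P.σ ^ 2 * x ^ 2 * deriv (deriv V) x = -(E ^ 2 / (2 * D)) := by
      rw [hV2, rhs, ← hDdef, ← hEdef, cutInf_eq_of_le hA hAa hE hAE hle]
      field_simp
      ring
    have hneg : deriv (deriv V) x < 0 := by
      have h1 : P.σ ^ 2 * x ^ 2 * deriv (deriv V) x < 0 := by
        rw [hV2']
        exact neg_neg_of_pos (by positivity)
      exact neg_of_mul_neg_right h1 (by positivity)
    have hαφ : P.alpha V x = 2 * D / E := by
      rw [halpha, hV2']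
      field_simp
    have hφa : 2 * D / E ≤ P.a := (div_le_iff₀ hE).2 hle
    have hstar : P.alphaStar V x = 2 * D / E := by
      rw [alphaStar, if_pos hneg, hαφ, if_neg hφa.not_gt, if_neg (by linarith)]
    -- Here V'' is the value that makes the discriminant in θ vanish, so the double root φ is the
    -- unique maximizer.
    have hLθ : ∀ θ, P.L θ V x = -((E * θ - 2 * D) ^ 2 / (4 * D)) := fun θ => by
      rw [hL, show P.σ ^ 2 * x ^ 2 * θ ^ 2 / 2 * deriv (deriv V) x
        = θ ^ 2 / 2 * (P.σ ^ 2 * x ^ 2 * deriv (deriv V) x) by ring, hV2']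
      field_simp
      ring
    have hmem : 2 * D / E ∈ Icc (-P.b) P.a := ⟨by linarith, hφa⟩
    have hsolve : P.SolvesHJBAt (2 * D / E) V x := by
      refine solvesHJBAt_of_le hmem ?_ fun θ _ => ?_
      · rw [hLθ, mul_div_cancel₀ _ hE.ne', sub_self]
        simp
      · rw [hLθ]
        exact neg_nonpos.2 (by positivity)
    rw [hstar, hαφ]
    refine ⟨fun _ => ⟨hneg.ne, hsolve⟩, fun h => absurd hle h.not_ge, hφ0, fun _ => ⟨rfl, rfl⟩,
      fun h => ?_, hmem, hsolve, fun θ _ hθ => ?_⟩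
    · rw [le_antisymm hle h, mul_div_cancel_right₀ _ hE.ne']
    · rw [hLθ, neg_eq_zero, div_eq_zero_iff] at hθ
      rcases hθ with hθ | hθ
      · rw [eq_div_iff hE.ne']
        linarith [pow_eq_zero_iff (two_ne_zero) |>.1 hθ]
      · linarith
  · set s := D / P.a ^ 2 - E / P.a with hs
    have hV2' : P.σ ^ 2 * x ^ 2 * deriv (deriv V) x = 2 * s := by
      rw [hV2, rhs, ← hDdef, ← hEdef, cutInf_eq_of_ge hA hAa hab hE hgt.le, ← hs]
      field_simp
    have hsE : -E < 2 * P.a * s := by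
      have : 2 * P.a * s + E = (2 * D - P.a * E) / P.a := by
        rw [hs]
        field_simp
        ring
      have : 0 < (2 * D - P.a * E) / P.a := div_pos (by linarith) ha
      linarith
    have hLθ : ∀ θ, P.L θ V x = (θ - P.a) * ((θ + P.a) * s + E) := fun θ => by
      rw [hL, show P.σ ^ 2 * x ^ 2 * θ ^ 2 / 2 * deriv (deriv V) x
        = θ ^ 2 / 2 * (P.σ ^ 2 * x ^ 2 * deriv (deriv V) x) by ring, hV2', hs]
      field_simp
      ring
    have hQ : ∀ θ ∈ Icc (-P.b) P.a, 0 < (θ + P.a) * s + E := fun θ hθ => by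
      have h1 : 0 ≤ θ + P.a := by linarith [hθ.1]
      rcases le_total 0 s with h | h
      · linarith [mul_nonneg h1 h]
      · nlinarith [mul_nonneg (sub_nonneg.2 hθ.2) (neg_nonneg.2 h)]
    have hstar : P.alphaStar V x = P.a := by
      have hk : 0 < P.σ ^ 2 * x ^ 2 := by positivity
      rw [alphaStar]
      rcases lt_trichotomy (deriv (deriv V) x) 0 with h | h | h
      · have hsneg : 2 * s < 0 := hV2' ▸ mul_neg_of_pos_of_neg hk h
        rw [if_pos h, if_pos]
        rw [halpha, hV2', lt_div_iff_of_neg hsneg]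
        linarith
      · rw [if_neg (by rw [h]; exact lt_irrefl 0), if_neg (by rw [h]; exact lt_irrefl 0),
          if_pos hμr.le]
      -- In the convex case α < 0 ≤ (a - b)/2, so the definition of α* selects a.
      · have hspos : 0 < 2 * s := hV2' ▸ mul_pos hk h
        rw [if_neg h.not_gt, if_pos h, if_pos]
        rw [halpha, hV2']
        have : -E / (2 * s) < 0 := div_neg_of_neg_of_pos (by linarith) hspos
        linarith
    have hmem : P.a ∈ Icc (-P.b) P.a := ⟨by linarith, le_rfl⟩
    have hsolve : P.SolvesHJBAt P.a V x := by
      refine solvesHJBAt_of_le hmem ?_ fun θ hθ => ?_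
      · rw [hLθ, sub_self, zero_mul]
      · rw [hLθ]
        exact mul_nonpos_of_nonpos_of_nonneg (by linarith [hθ.2]) (hQ θ hθ).le
    rw [hstar]
    refine ⟨fun h => absurd hgt h.not_gt, fun _ => hsolve, hφ0, fun h => absurd hgt h.not_gt,
      fun _ => rfl, hmem, hsolve, fun θ hθ h0 => ?_⟩
    rw [hLθ] at h0
    rcases mul_eq_zero.1 h0 with h | h
    · linarith
    · exact absurd h (hQ θ hθ).ne'

theorem cutoff_pos {n : ℕ} (hn : 2 ≤ n) : 0 < P.beta / n :=
  div_pos (lt_min P.a_pos P.b_pos) (by exact_mod_cast (by omega : 0 < n))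

theorem cutoff_lt {n : ℕ} (hn : 2 ≤ n) : P.beta / n < P.a := by
  have hβ : 0 < P.beta := lt_min P.a_pos P.b_pos
  have h1 : (1 : ℝ) < n := by exact_mod_cast (by omega : 1 < n)
  exact (div_lt_self hβ h1).trans_le (min_le_left _ _)

theorem phi_eq {W V g : ℝ → ℝ} (hW : ∀ x, HasDerivAt W (g x) x)
    (hWV : ∀ x, 0 < x → W x = V x) {x : ℝ} (hx : 0 < x) :
    P.phi V x = 2 * P.excess W g x / P.riskGain g x := by
  have hd : deriv V x = g x := by
    refine ((hW x).congr_of_eventuallyEq ?_).deriv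
    filter_upwards [lt_mem_nhds hx] with z hz using (hWV z hz).symm
  rw [phi, excess, riskGain, hd, M_congr hx fun y hy _ => hWV y hy]

/-- On bounded intervals the extensions do not depend on the cut-off once it is small. -/
theorem exists_stable (hμr : P.r < P.μ) (hab : P.b ≤ P.a) {Va : ℝ → ℝ} {ε : ℝ}
    {Vn : ℕ → ℝ → ℝ} (h : P.IsConstantSolution P.a Va) (hε : 0 < ε)
    (hH : ∀ x, 0 < x → x < ε → P.SolvesHJBAt P.a Va x)
    (hext : ∀ n : ℕ, 2 ≤ n → P.IsExtension Va ε (P.beta / n) (Vn n)) (X : ℝ) :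
    ∃ N : ℕ, 2 ≤ N ∧
      (∀ n : ℕ, N ≤ n → ∀ x, 0 < x → x ≤ X → P.beta / n < P.phi (Vn n) x ∧ Vn n x = Vn N x) ∧
      ∃ W g : ℝ → ℝ, P.IsCutoffSolution (P.beta / N) W g ∧ (∀ x, 0 < x → W x = Vn N x) ∧
        ∀ x, 0 < x → x ≤ X → P.beta / N * P.riskGain g x < 2 * P.excess W g x := by
  wlog hX : ε ≤ X generalizing X
  · obtain ⟨N, hN, h1, W, g, h2, h3, h4⟩ := this ε le_rfl
    have hXε : X ≤ ε := (not_le.1 hX).le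
    exact ⟨N, hN, fun n hn x hx hxX => h1 n hn x hx (hxX.trans hXε), W, g, h2, h3,
      fun x hx hxX => h4 x hx (hxX.trans hXε)⟩
  obtain ⟨U, k, hk, hU, hU0, hk0, hUeq, hkeq, -, hkpos, hge, -⟩ := h.exists_extension hμr hab hH
  have hsol : ∀ n : ℕ, ∃ W g : ℝ → ℝ, 2 ≤ n → (P.IsCutoffSolution (P.beta / n) W g ∧
      (∀ x, 0 < x → W x = Vn n x) ∧
      (∀ x, 0 < x → x ≤ ε → W x = Va x ∧ g x = deriv Va x) ∧
      ∀ x, 0 < x → x ≤ ε → P.a * P.riskGain g x ≤ 2 * P.excess W g x) := fun n => by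
    by_cases hn : 2 ≤ n
    · obtain ⟨W, g, hWg⟩ :=
        (hext n hn).exists_cutoffSolution hμr hab h hε hH (cutoff_pos hn) (cutoff_lt hn)
      exact ⟨W, g, fun _ => hWg⟩
    · exact ⟨0, 0, fun h => absurd h hn⟩
  choose W g hWg using hsol
  have hgk : ∀ n, 2 ≤ n → ∀ x, 0 ≤ x → x ≤ ε → g n x = k x := fun n hn x hx hxε => by
    obtain ⟨hcs, -, hVa, -⟩ := hWg n hn
    rcases eq_or_lt_of_le hx with rfl | hx'
    · rw [hcs.init, hk0]
    · rw [(hVa x hx' hxε).2, hkeq x hx']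
  have hWU : ∀ n, 2 ≤ n → ∀ x, 0 < x → x ≤ ε → W n x = U x := fun n hn x hx hxε => by
    rw [((hWg n hn).2.2.1 x hx hxε).1, hUeq x hx]
  have hkε := hkpos ε hε.le le_rfl
  have hUε : 0 < U ε := by
    have := le_of_deriv_nonneg hU (fun y hy hyε => (hkpos y hy hyε.le).le) le_rfl hε.le le_rfl
    linarith
  have hDε : 0 < P.excess U k ε := by
    have h1 := hge ε hε le_rfl
    have h2 := mul_pos P.a_pos (riskGain_pos hμr hε hkε)
    linarith
  obtain ⟨G₀, hG₀⟩ := (isCompact_Icc (a := (0 : ℝ)) (b := ε)).exists_bound_of_continuousOn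
    hk.continuousOn
  obtain ⟨δ, hδ, hδa, hbound⟩ := IsCutoffSolution.exists_phi_bound P hμr hab (G₀ := G₀) hε hX
    hUε hkε hDε
  have hlim : Tendsto (fun n : ℕ => P.beta / n) atTop (𝓝 0) :=
    tendsto_const_div_atTop_nhds_zero_nat _
  obtain ⟨N₀, hN₀⟩ := eventually_atTop.1 (hlim.eventually (gt_mem_nhds hδ))
  have hsmall : ∀ n, max N₀ 2 ≤ n → ∀ x, 0 < x → x ≤ X →
      δ * P.riskGain (g n) x ≤ 2 * P.excess (W n) (g n) x := fun n hn x hx hxX => by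
    have hn2 : 2 ≤ n := (le_max_right _ _).trans hn
    obtain ⟨hcs, hWV, hVa, hφ⟩ := hWg n hn2
    have hgx := hcs.pos hab (cutoff_pos hn2) (cutoff_lt hn2) hx.le
    rcases le_total x ε with hxε | hxε
    · exact (mul_le_mul_of_nonneg_right hδa.le (riskGain_pos hμr hx hgx).le).trans (hφ x hx hxε)
    · refine hbound (P.beta / n) (W n) (g n) (cutoff_pos hn2)
        (hN₀ n ((le_max_left _ _).trans hn)) hcs (hWU n hn2 ε hε le_rfl)
        (hgk n hn2 ε hε.le le_rfl) ?_ (fun y hy hyε => ?_) x ⟨hxε, hxX⟩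
      · rw [excess, excess, hgk n hn2 ε hε.le le_rfl, M_congr hε (hWU n hn2)]
      · rw [hgk n hn2 y hy hyε]
        exact (le_abs_self _).trans (hG₀ y ⟨hy, hyε⟩)
  set N := max N₀ 2 with hN
  have hN2 : 2 ≤ N := le_max_right _ _
  -- The indices of solution and cut-off are decoupled, so that the n-th solution can be put into
  -- the equation with the N-th cut-off.
  have hstrict : ∀ n, N ≤ n → ∀ j, N ≤ j → ∀ x, 0 < x → x ≤ X →
      P.beta / j * P.riskGain (g n) x < 2 * P.excess (W n) (g n) x := fun n hn j hj x hx hxX => by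
    have hn2 : 2 ≤ n := hN2.trans hn
    have hgx := (hWg n hn2).1.pos hab (cutoff_pos hn2) (cutoff_lt hn2) hx.le
    exact (mul_lt_mul_of_pos_right (hN₀ j ((le_max_left _ _).trans hj))
      (riskGain_pos hμr hx hgx)).trans_le (hsmall n hn x hx hxX)
  refine ⟨N, hN2, fun n hn x hx hxX => ?_, W N, g N, (hWg N hN2).1, (hWg N hN2).2.1,
    fun x hx hxX => hstrict N le_rfl N le_rfl x hx hxX⟩
  have hn2 : 2 ≤ n := hN2.trans hn
  obtain ⟨hcs, hWV, hVa, -⟩ := hWg n hn2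
  obtain ⟨hcsN, hWVN, hVaN, -⟩ := hWg N hN2
  have hpos : ∀ y, 0 ≤ y → 0 < g n y := fun y hy =>
    hcs.pos hab (cutoff_pos hn2) (cutoff_lt hn2) hy
  constructor
  · rw [phi_eq hcs.deriv hWV hx, lt_div_iff₀ (riskGain_pos hμr hx (hpos x hx.le))]
    exact hstrict n hn n hn x hx hxX
  · rw [← hWV x hx, ← hWVN x hx]
    refine eqOn_of_hasDerivAt_rhs hμr (cutoff_pos hN2) (cutoff_lt hN2) hε hcs.cont hcsN.cont
      hcs.deriv hcsN.deriv (by rw [hcs.zero, hcsN.zero])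
      (fun y hy hyε => by rw [hgk n hn2 y hy hyε, hgk N hN2 y hy hyε]) (fun y hy => ?_)
      (fun y hy => hcsN.eq y (hε.trans_le hy.1)) x hx.le hxX
    have hy0 : 0 < y := hε.trans_le hy.1
    -- As φ exceeds both cut-offs, the two infima coincide, and uniqueness for a single equation
    -- applies.
    rw [rhs, ← cutInf_eq_cutInf hab (cutoff_pos hn2) (cutoff_lt hn2) (cutoff_pos hN2)
      (cutoff_lt hN2) (riskGain_pos hμr hy0 (hpos y hy0.le)) (hstrict n hn n hn y hy0 hy.2)
      (hstrict n hn N le_rfl y hy0 hy.2)]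
    exact hcs.eq y hy0

/-- Where φ exceeds the cut-off, so does |φ|; thus no point of (0, X] competes in the infimum
defining x_n^*. -/
theorem tendsto_xStar {Vn : ℕ → ℝ → ℝ}
    (hst : ∀ X : ℝ, ∃ N : ℕ, ∀ n : ℕ, N ≤ n → ∀ x, 0 < x → x ≤ X → P.beta / n < P.phi (Vn n) x) :
    Tendsto (fun n => P.xStar n (Vn n)) atTop (𝓝 ⊤) := by
  rw [EReal.tendsto_nhds_top_iff_real]
  intro X
  obtain ⟨N, hN⟩ := hst (X + 1)
  filter_upwards [eventually_ge_atTop N] with n hn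
  refine lt_of_lt_of_le (b := ((X + 1 : ℝ) : EReal)) (by exact_mod_cast lt_add_one X) ?_
  refine le_sInf ?_
  rintro _ ⟨x, ⟨hx, hφ⟩, rfl⟩
  rw [EReal.coe_le_coe_iff]
  by_contra! hlt
  have := hN n hn x hx hlt.le
  linarith [le_abs_self (P.phi (Vn n) x)]

theorem exists_isConstructedSolution (hμr : P.r < P.μ) (hab : P.b ≤ P.a) :
    ∃ V, P.IsConstructedSolution V := by
  obtain ⟨Va, hVa⟩ := exists_isConstantSolution hμr
  obtain ⟨ε, hε, hH⟩ := hVa.exists_solvesHJB hμr hab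
  have hex : ∀ n : ℕ, ∃ V, 2 ≤ n → P.IsExtension Va ε (P.beta / n) V := fun n => by
    by_cases hn : 2 ≤ n
    · obtain ⟨V, hV⟩ := exists_isExtension hμr hab hVa hε hH (cutoff_pos hn) (cutoff_lt hn)
      exact ⟨V, fun _ => hV⟩
    · exact ⟨0, fun h => absurd h hn⟩
  choose Vn hVn using hex
  have hst := exists_stable hμr hab hVa hε hH hVn
  have hlim : ∀ x : ℝ, ∃ l, 0 < x → Tendsto (fun n => Vn n x) atTop (𝓝 l) := fun x => by
    obtain ⟨N, -, hN, -⟩ := hst x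
    refine ⟨Vn N x, fun hx => tendsto_const_nhds.congr' ?_⟩
    filter_upwards [eventually_ge_atTop N] with n hn using (hN n hn x hx le_rfl).2.symm
  choose V hV using hlim
  refine ⟨V, Va, ε, Vn, ⊤, hVa, hε, hH, hVn, tendsto_xStar fun X => ?_, fun x hx _ => hV x hx⟩
  obtain ⟨N, -, hN, -⟩ := hst X
  exact ⟨N, fun n hn x hx hxX => (hN n hn x hx hxX).1⟩

/-- On a bounded interval a constructed function solves the equation with a small cut-off. -/
theorem IsConstructedSolution.exists_cutoffSolution (hμr : P.r < P.μ) (hab : P.b ≤ P.a)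
    {V : ℝ → ℝ} (hV : P.IsConstructedSolution V) (X : ℝ) :
    ∃ A W g, 0 < A ∧ A < P.a ∧ P.IsCutoffSolution A W g ∧ (∀ x, 0 < x → x ≤ X → V x = W x) ∧
      ∀ x, 0 < x → x ≤ X → A * P.riskGain g x < 2 * P.excess W g x := by
  obtain ⟨Va, ε, Vn, xs, hVa, hε, hH, hVn, hxs, hlim⟩ := hV
  have hst := exists_stable hμr hab hVa hε hH hVn
  -- Whatever choices were made in the construction, x* = ∞; hence V is determined as a limit on the
  -- whole half line.
  have htop : xs = ⊤ := tendsto_nhds_unique hxs (tendsto_xStar fun X => by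
    obtain ⟨N, -, hN, -⟩ := hst X
    exact ⟨N, fun n hn x hx hxX => (hN n hn x hx hxX).1⟩)
  obtain ⟨N, hN2, hN, W, g, hWg, hWV, hφ⟩ := hst X
  refine ⟨P.beta / N, W, g, cutoff_pos hN2, cutoff_lt hN2, hWg, fun x hx hxX => ?_, hφ⟩
  rw [hWV x hx]
  refine tendsto_nhds_unique (hlim x hx (htop ▸ EReal.coe_lt_top x))
    (tendsto_const_nhds.congr' ?_)
  filter_upwards [eventually_ge_atTop N] with n hn using (hN n hn x hx hxX).2.symm

/-- The local form of the equation for a constructed function. -/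
theorem IsConstructedSolution.local_equation (hμr : P.r < P.μ) (hab : P.b ≤ P.a)
    {V : ℝ → ℝ} (hV : P.IsConstructedSolution V) {x : ℝ} (hx : 0 < x) :
    ∃ A g', 0 < A ∧ A < P.a ∧ 0 < deriv V x ∧
      A * P.riskGain (deriv V) x < 2 * P.excess V (deriv V) x ∧
      HasDerivAt V (deriv V x) x ∧ HasDerivAt (deriv V) (g' x) x ∧ ContinuousAt g' x ∧
      (∀ᶠ z in 𝓝 x, deriv (deriv V) z = g' z) ∧ g' x = P.rhs A V (deriv V) x := by
  obtain ⟨A, W, g, hA, hAa, h, hVW, hφ⟩ := hV.exists_cutoffSolution hμr hab (x + 1)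
  have hnhds : ∀ z ∈ Ioo 0 (x + 1), V =ᶠ[𝓝 z] W := fun z hz => by
    filter_upwards [Ioo_mem_nhds hz.1 hz.2] with y hy using hVW y hy.1 hy.2.le
  have hd : ∀ z ∈ Ioo 0 (x + 1), HasDerivAt V (g z) z := fun z hz =>
    (h.deriv z).congr_of_eventuallyEq (hnhds z hz)
  have hd2 : ∀ z ∈ Ioo 0 (x + 1), HasDerivAt (deriv V) (P.rhs A W g z) z := fun z hz => by
    refine (h.eq z hz.1).congr_of_eventuallyEq ?_
    filter_upwards [Ioo_mem_nhds hz.1 hz.2] with y hy using (hd y hy).deriv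
  have hxm : x ∈ Ioo 0 (x + 1) := ⟨hx, lt_add_one x⟩
  have hdx : deriv V x = g x := (hd x hxm).deriv
  have hexc : P.excess V (deriv V) x = P.excess W g x := by
    rw [excess, excess, hdx, M_congr hx fun y hy hyx => hVW y hy (by linarith)]
  have hrg : P.riskGain (deriv V) x = P.riskGain g x := by
    rw [riskGain, riskGain, hdx]
  refine ⟨A, P.rhs A W g, hA, hAa, ?_, ?_, ?_, hd2 x hxm, ?_, ?_, ?_⟩
  · rw [hdx]
    exact h.pos hab hA hAa hx.le
  · rw [hexc, hrg]
    exact hφ x hx (by linarith)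
  · rw [hdx]
    exact hd x hxm
  · exact (continuousOn_rhs hA hAa h.continuous h.cont).continuousAt (Ioi_mem_nhds hx)
  · filter_upwards [Ioo_mem_nhds hxm.1 hxm.2] with z hz using (hd2 z hz).deriv
  · rw [rhs, rhs, hexc, hrg]

end SurplusModel

end

theorem mainTheorem4 (P : SurplusModel) (hμr : P.r < P.μ) (hab : P.b ≤ P.a) :
    (∃ V : ℝ → ℝ, P.IsConstructedSolution V) ∧
    ∀ V : ℝ → ℝ, P.IsConstructedSolution V →
      ContDiffOn ℝ 2 V (Set.Ioi 0) ∧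
      (∀ x, 0 < x → 0 < deriv V x) ∧
      (∀ x ∈ P.S₁ V, deriv (deriv V) x ≠ 0 ∧ P.SolvesHJBAt (P.alpha V x) V x) ∧
      (∀ x ∈ P.S₂ V, P.SolvesHJBAt P.a V x) ∧
      ∀ x, 0 < x →
        0 < P.phi V x ∧
        (P.phi V x < P.a → P.alphaStar V x = P.alpha V x ∧ P.alpha V x = P.phi V x) ∧
        (P.a ≤ P.phi V x → P.alphaStar V x = P.a) ∧
        P.alphaStar V x ∈ Set.Icc (-P.b) P.a ∧
        P.SolvesHJBAt (P.alphaStar V x) V x ∧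
        (∀ θ ∈ Set.Icc (-P.b) P.a, P.L θ V x = 0 → θ = P.alphaStar V x) := by
  refine ⟨SurplusModel.exists_isConstructedSolution hμr hab, fun V hV => ?_⟩
  refine ⟨contDiffOn_two_Ioi (g := deriv V) (g' := deriv (deriv V)) (fun x hx => ?_)
    (fun x hx => ?_) (fun x hx => ?_), fun x hx => ?_, fun x hx => ?_, fun x hx => ?_,
    fun x hx => ?_⟩
  · obtain ⟨A, g', -, -, -, -, hd, -⟩ := hV.local_equation hμr hab hx
    exact hd
  · obtain ⟨A, g', -, -, -, -, -, hd, -⟩ := hV.local_equation hμr hab hx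
    exact hd.differentiableAt.hasDerivAt
  · obtain ⟨A, g', -, -, -, -, -, -, hc, hev, -⟩ := hV.local_equation hμr hab hx
    exact (hc.congr (hev.mono fun z hz => hz.symm)).continuousWithinAt
  · obtain ⟨A, g', -, -, hpos, -⟩ := hV.local_equation hμr hab hx
    exact hpos
  · obtain ⟨A, g', hA, hAa, hpos, hAE, -, -, -, hev, heq⟩ := hV.local_equation hμr hab hx.1
    exact (SurplusModel.optimality_at hμr hab hx.1 hA hAa hpos hAE
      (hev.self_of_nhds.trans heq)).1 hx.2
  · obtain ⟨A, g', hA, hAa, hpos, hAE, -, -, -, hev, heq⟩ := hV.local_equation hμr hab hx.1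
    exact (SurplusModel.optimality_at hμr hab hx.1 hA hAa hpos hAE
      (hev.self_of_nhds.trans heq)).2.1 hx.2
  · obtain ⟨A, g', hA, hAa, hpos, hAE, -, -, -, hev, heq⟩ := hV.local_equation hμr hab hx
    exact (SurplusModel.optimality_at hμr hab hx hA hAa hpos hAE
      (hev.self_of_nhds.trans heq)).2.2
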